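/- Let $\eta:S^n\to S^m$ be a $C^2$ map between unit spheres and $\theta\in(0,\pi/2)$ such that $F(x)=(\cos\theta\cdot x,\ \sin\theta\cdot\eta(x))$ is a minimal immersion of $S^n$ into the unit sphere $S^{m+n+1}\subset\mathbb R^{n+1}\times\mathbb R^{m+1}$, and such that at every point $x$ the set of the $n$ singular values of the differential $(\eta_*)_x:T_xS^n\to T_{\eta(x)}S^m$ (for the round metrics) is of the form $\{0,\lambda\}$ with $\lambda>0$ (such an $\eta$ is called an LOMSE). Let $\lambda>0$ be the nonzero singular value and $p$ its multiplicity at a point of $S^n$ (both are in fact independent of the point). Say that $\eta$ is of $(n,p,k)$ type if the coordinate functions of $\eta$ in $\mathbb R^{m+1}$ are restrictions to $S^n$ of harmonic homogeneous polynomials of degree $k$ on $\mathbb R^{n+1}$. Call $\eta$ of Type (I) if it is of $(3,2,2)$, $(5,4,2)$ or $(5,4,4)$ type or if $n\ge 7$, and of Type (II) if it is of $(3,2,k)$ type with $k\ge4$ or of $(5,4,k)$ type with $k\ge 6$. Equip the orbit space $\{(r,\rho):r\ge0\}$ with the (degenerate at $r=0$) conformal metric $$\sigma_0^2\,(r^2+\lambda^2\rho^2)^p\,r^{2(n-p)}\,(dr^2+d\rho^2),$$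 where $\sigma_0$ is the volume of the unit sphere $S^n$. Let $\overline{0Q}$ be the segment $t\mapsto(t,t\tan\theta)$, $t\in[0,1]$, from the origin to $Q=(1,\tan\theta)$. A proper variation of it is a smooth map $\Gamma:\mathbb R\times\mathbb R\to\mathbb R^2$ with $\Gamma(0,t)=(t,t\tan\theta)$ for $t\in[0,1]$, with $\Gamma(s,0)=0$ and $\Gamma(s,1)=Q$ for all $s$, and with $\Gamma(s,\cdot)|_{[0,1]}$ in the orbit space for all small $s$; let $\ell_\Gamma(s)$ be the length of $\Gamma(s,\cdot)|_{[0,1]}$. Then: (a) $\overline{0Q}$ is a geodesic (up to parametrization): $\ell_\Gamma'(0)=0$ for every proper variation $\Gamma$. (b) If $\eta$ is of Type (I), then $\overline{0Q}$ is stable: for every proper variation $\Gamma$, $\ell_\Gamma$ is $C^2$ near $0$ and $\ell_\Gamma''(0)\ge0$. (c) If $\eta$ is of Type (II), then $\overline{0Q}$ is unstable: there is a proper variation $\Gamma$ such that $\ell_\Gamma$ is $C^2$ near $0$ and $\ell_\Gamma''(0)<0$. -/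

import Mathlib

open Set Filter Topology MeasureTheory
open scoped ContDiff Manifold

noncomputable section

namespace LawsonOsserman

/-- `EuclideanSpace ℝ (Fin (d + 1))`, the ambient space of the unit sphere `S^d`. -/
abbrev Amb (d : ℕ) : Type := EuclideanSpace ℝ (Fin (d + 1))

/-- The unit sphere `S^d`. -/
abbrev Sph (d : ℕ) : Type := Metric.sphere (0 : Amb d) 1

instance instFactFinrankAmb (d : ℕ) : Fact (Module.finrank ℝ (Amb d) = d + 1) :=
  ⟨finrank_euclideanSpace_fin⟩

/-- The ambient space `ℝ^(n+1) × ℝ^(m+1) = ℝ^(m+n+2)` with its Euclidean norm. -/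
abbrev Amb2 (n m : ℕ) : Type := WithLp 2 (Amb n × Amb m)

theorem inv_norm_smul_mem_sphere {d : ℕ} {y : Amb d} (hy : y ≠ 0) :
    ‖y‖⁻¹ • y ∈ Metric.sphere (0 : Amb d) 1 := by
  rw [mem_sphere_zero_iff_norm, norm_smul, norm_inv, norm_norm,
    inv_mul_cancel₀ (norm_ne_zero_iff.mpr hy)]

section Immersions

variable {d : ℕ} {V : Type*} [NormedAddCommGroup V] [InnerProductSpace ℝ V]

/-- The extension of a map `F` on `S^d`, constant along rays: `y ↦ F (y / ‖y‖)` for `y ≠ 0`. -/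
def radialExt (F : Sph d → V) (y : Amb d) : V :=
  open Classical in
  if hy : y ≠ 0 then F ⟨‖y‖⁻¹ • y, inv_norm_smul_mem_sphere hy⟩ else 0

/-- The tangent space `T_x S^d`, as the orthogonal complement of `x` (with the inner product of the
round metric). -/
abbrev TSph (x : Sph d) : Submodule ℝ (Amb d) := (Submodule.span ℝ {(x : Amb d)})ᗮ

/-- The differential of `F` at `x`, as a linear map on `T_x S^d`. -/
def sphereDeriv (F : Sph d → V) (x : Sph d) : TSph x →ₗ[ℝ] V :=
  (fderiv ℝ (radialExt F) (x : Amb d)).toLinearMap ∘ₗ (TSph x).subtype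

/-- The directions in `V` that are normal to the immersion `F` inside the unit sphere of `V`: the
orthogonal complement of the position vector `F x` and of the tangent space `dF_x (T_x S^d)`. -/
def normalSpace (F : Sph d → V) (x : Sph d) : Submodule ℝ V :=
  (Submodule.span ℝ {F x} ⊔ LinearMap.range (sphereDeriv F x))ᗮ

/-- The second fundamental form of `F` as an immersion into the unit sphere of `V`: the normal part
of the second derivative of `F` (taken in the local parametrization `u ↦ (x + u) / ‖x + u‖` of
`S^d`, `u ∈ T_x S^d`). -/
def secondFundamentalForm [FiniteDimensional ℝ V] (F : Sph d → V) (x : Sph d) (u v : TSph x) : V :=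
  (normalSpace F x).starProjection
    (fderiv ℝ (fderiv ℝ (radialExt F)) (x : Amb d) (u : Amb d) (v : Amb d))

/-- `F` is a minimal `C²` immersion of `S^d` into the unit sphere of `V`: its mean curvature, i.e.
the trace of the second fundamental form with respect to the metric induced by `F`, vanishes. -/
structure IsMinimalImmersion [FiniteDimensional ℝ V] (F : Sph d → V) : Prop where
  norm_eq_one : ∀ x, ‖F x‖ = 1
  contDiffOn : ContDiffOn ℝ 2 (radialExt F) {0}ᶜ
  immersion : ∀ x, Function.Injective (sphereDeriv F x)
  meanCurvature_eq_zero : ∀ (x : Sph d) (e : Fin d → TSph x),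
    (∀ i j, inner ℝ (sphereDeriv F x (e i)) (sphereDeriv F x (e j)) = if i = j then (1 : ℝ) else 0) →
    ∑ i, secondFundamentalForm F x (e i) (e i) = 0

end Immersions

/-- The map `x ↦ (cos θ · x, sin θ · η(x))` from `S^n` to `S^(m+n+1) ⊂ ℝ^(n+1) × ℝ^(m+1)`. -/
def sphericalGraph {n m : ℕ} (η : Sph n → Sph m) (θ : ℝ) (x : Sph n) : Amb2 n m :=
  WithLp.toLp 2 (Real.cos θ • (x : Amb n), Real.sin θ • (η x : Amb m))

/-- `η` is a Lawson-Osserman map (LOM) with angle `θ ∈ (0, π/2)`. -/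
structure IsLOM {n m : ℕ} (η : Sph n → Sph m) (θ : ℝ) : Prop where
  contMDiff : ContMDiff (𝓡 n) (𝓡 m) 2 η
  angle_mem : θ ∈ Ioo 0 (Real.pi / 2)
  minimal : IsMinimalImmersion (sphericalGraph η θ)

/-- The singular values `λ_0 ≥ … ≥ λ_{n-1}` of `(η_*)_x`, repeated with multiplicity. -/
def singVal {n m : ℕ} (η : Sph n → Sph m) (x : Sph n) (i : Fin n) : ℝ :=
  (sphereDeriv (fun y => (η y : Amb m)) x).singularValues i

/-- `η` is an LOMSE with angle `θ`: an LOM such that at each point `{λ_0, …, λ_{n-1}} = {0, lam}`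
for some `lam > 0`. -/
structure IsLOMSE {n m : ℕ} (η : Sph n → Sph m) (θ : ℝ) : Prop where
  isLOM : IsLOM η θ
  singVal_range : ∀ x, ∃ lam : ℝ, 0 < lam ∧ range (singVal η x) = {0, lam}

/-- All coordinate functions of `η` are spherical harmonics of degree `k`: restrictions to `S^n` of
harmonic homogeneous polynomials of degree `k` on `ℝ^(n+1)`. -/
def HasHarmonicDegree {n m : ℕ} (η : Sph n → Sph m) (k : ℕ) : Prop :=
  ∀ j : Fin (m + 1), ∃ P : MvPolynomial (Fin (n + 1)) ℝ,
    P.IsHomogeneous k ∧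
    ∑ i, MvPolynomial.pderiv i (MvPolynomial.pderiv i P) = 0 ∧
    ∀ x : Sph n, (η x : Amb m) j = MvPolynomial.eval (fun i => (x : Amb n) i) P

/-- Type (I), for a map `η : S^n → S^m` whose nonzero singular value has multiplicity `p`. -/
def IsTypeI {n m : ℕ} (η : Sph n → Sph m) (p : ℕ) : Prop :=
  (∃ k : ℕ, HasHarmonicDegree η k ∧
    ((n, p, k) = (3, 2, 2) ∨ (n, p, k) = (5, 4, 2) ∨ (n, p, k) = (5, 4, 4))) ∨ 7 ≤ n

/-- Type (II), for a map `η : S^n → S^m` whose nonzero singular value has multiplicity `p`. -/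
def IsTypeII {n m : ℕ} (η : Sph n → Sph m) (p : ℕ) : Prop :=
  ∃ k : ℕ, HasHarmonicDegree η k ∧
    (((n, p) = (3, 2) ∧ 4 ≤ k) ∨ ((n, p) = (5, 4) ∧ 6 ≤ k))

/-- The volume `σ₀` of the unit sphere `S^n`. -/
def sphereVolume (n : ℕ) : ℝ :=
  ((volume : Measure (Amb n)).toSphere).real univ

/-- The orbit space, in the coordinates `(r, ρ)`. -/
def orbitSpace : Set (ℝ × ℝ) := {q | 0 ≤ q.1}

/-- The metric `σ₀² [(r² + lam² ρ²)^p r^(2(n-p))] (dr² + dρ²)` of the orbit space at the point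
`q = (r, ρ)`, evaluated on the tangent vectors `v` and `w`. -/
def orbitMetric (n p : ℕ) (lam : ℝ) (q v w : ℝ × ℝ) : ℝ :=
  sphereVolume n ^ 2 * ((q.1 ^ 2 + lam ^ 2 * q.2 ^ 2) ^ p * q.1 ^ (2 * (n - p))) *
    (v.1 * w.1 + v.2 * w.2)

/-- The length of a curve `c : [0,1] → orbitSpace`. -/
def orbitLength (n p : ℕ) (lam : ℝ) (c : ℝ → ℝ × ℝ) : ℝ :=
  ∫ t in (0 : ℝ)..1, √(orbitMetric n p lam (c t) (deriv c t) (deriv c t))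

/-- `Γ (s, t)` is a smooth variation of the curve `c : [0,1] → orbitSpace` with fixed endpoints. -/
structure IsProperVariation (c : ℝ → ℝ × ℝ) (Γ : ℝ × ℝ → ℝ × ℝ) : Prop where
  contDiff : ContDiff ℝ ∞ Γ
  base : ∀ t ∈ Icc (0 : ℝ) 1, Γ (0, t) = c t
  left : ∀ s, Γ (s, 0) = c 0
  right : ∀ s, Γ (s, 1) = c 1
  mem_orbitSpace : ∀ᶠ s in 𝓝 (0 : ℝ), ∀ t ∈ Icc (0 : ℝ) 1, Γ (s, t) ∈ orbitSpace

/-- The length of the curve `Γ (s, ·)`, as a function of `s`. -/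
def variationLength (n p : ℕ) (lam : ℝ) (Γ : ℝ × ℝ → ℝ × ℝ) (s : ℝ) : ℝ :=
  orbitLength n p lam (fun t => Γ (s, t))

/-- `c` is a geodesic (up to parametrization): a critical point of length under variations with
fixed endpoints. -/
def IsOrbitGeodesic (n p : ℕ) (lam : ℝ) (c : ℝ → ℝ × ℝ) : Prop :=
  ∀ Γ, IsProperVariation c Γ → HasDerivAt (variationLength n p lam Γ) 0 0

/-- `c` is stable: the second variation of length exists and is nonnegative for all variations with
fixed endpoints. -/
def IsStableCurve (n p : ℕ) (lam : ℝ) (c : ℝ → ℝ × ℝ) : Prop :=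
  ∀ Γ, IsProperVariation c Γ →
    ContDiffAt ℝ 2 (variationLength n p lam Γ) 0 ∧
      0 ≤ deriv (deriv (variationLength n p lam Γ)) 0

/-- `c` is unstable: the second variation of length is negative for some variation with fixed
endpoints. -/
def IsUnstableCurve (n p : ℕ) (lam : ℝ) (c : ℝ → ℝ × ℝ) : Prop :=
  ∃ Γ, IsProperVariation c Γ ∧
    ContDiffAt ℝ 2 (variationLength n p lam Γ) 0 ∧
      deriv (deriv (variationLength n p lam Γ)) 0 < 0

/-- The line segment from the origin to `Q = (1, tan θ)`, parametrized by `[0,1]`. -/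
def segmentOQ (θ : ℝ) (t : ℝ) : ℝ × ℝ := (t, t * Real.tan θ)

end LawsonOsserman

end

noncomputable section

namespace LawsonOsserman

/-! The argument turns on the number `D = ((n - 1) / 2) ^ 2 - n + 2 n ^ 2 / (p λ ^ 2)`: the segment
is stable when `D > 0` and unstable when `D < 0`.

Two identities for `η` feed the plane problem. Vanishing mean curvature in the normal direction
`(-sin θ · x, cos θ · η x)` gives `p (λ ^ 2 - 1) = (n - p) (1 + λ ^ 2 tan ^ 2 θ)`
(`sum_singVal_eq_zero`, `IsLOM.critical_angle`). It says that on the ray through `Q` the conformal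
factor is critical in the direction orthogonal to the ray. If the coordinates are harmonic of degree
`k`, comparing Laplacians in `∑ P_j ^ 2 = |y| ^ (2 k)` gives `p λ ^ 2 = k (k + n - 1)`
(`sum_sq_singVal`).

The metric degenerates at the origin, but it is homogeneous: writing `Γ = t H` with `H` smooth, the
length integrand is `t ^ n` times a root that is smooth near the ray (`exists_smooth_quotient`,
`variationLength_eq`). So the length may be differentiated twice under the integral.

Geodesic and stable cases use a calibration. With `X` and `Y` the coordinates along and across the
ray, take `f = c (X ^ (n + 1) + b X ^ (n - 1) Y ^ 2)`. The integral of `df` along a variation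
depends only on the endpoints. For `b = 0` the integrand and `df` agree to first order at the
segment, so the first variation vanishes. For the optimal `b`, `D > 0` makes `|df|` at most the
metric density in a narrow cone around the ray (`eventually_calibration_le`). Nearby curves stay in
that cone, so the segment locally minimises length along every variation.

In the unstable case the second variation under vertical variations is a Hardy-type quadratic form.
If `D < 0`, the critical power `t ^ (-(n - 1) / 2)`, cut off slowly on the logarithmic scale, makes
it negative (`exists_negative_test`). -/

theorem continuousOn_slice {E V : Type*} [TopologicalSpace E] [TopologicalSpace V] {F : E × ℝ → V} {x : E}
    (hF : ∀ t ∈ Icc (0 : ℝ) 1, ContinuousAt F (x, t)) :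
    ContinuousOn (fun t => F (x, t)) (uIcc (0 : ℝ) 1) := by
  rw [uIcc_of_le zero_le_one]
  intro t ht
  exact (ContinuousAt.comp (f := fun t : ℝ => (x, t)) (hF t ht)
    (by fun_prop)).continuousWithinAt

/-! ### Differentiation of integrals over `[0,1]` with respect to a parameter. -/

section ParametricIntegral

variable {E V : Type*} [NormedAddCommGroup E] [NormedSpace ℝ E] [NormedAddCommGroup V]
  [NormedSpace ℝ V]

theorem eventually_forall_contDiffAt {F : E × ℝ → V} {x₀ : E} {k : WithTop ℕ∞} (hk : k ≠ ∞)
    (hF : ∀ t ∈ Icc (0 : ℝ) 1, ContDiffAt ℝ k F (x₀, t)) :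
    ∀ᶠ x in 𝓝 x₀, ∀ t ∈ Icc (0 : ℝ) 1, ContDiffAt ℝ k F (x, t) :=
  isCompact_Icc.eventually_forall_of_forall_eventually fun t ht =>
    (hF t ht).eventually hk

/-- Differentiation of `∫₀¹ F (x, t) dt` with respect to the parameter `x`. -/
theorem hasFDerivAt_integral_slice {F : E × ℝ → V} {x₀ : E}
    (hF : ∀ t ∈ Icc (0 : ℝ) 1, ContDiffAt ℝ 1 F (x₀, t)) :
    HasFDerivAt (fun x => ∫ t in (0 : ℝ)..1, F (x, t))
      (∫ t in (0 : ℝ)..1, (fderiv ℝ F (x₀, t)).comp (ContinuousLinearMap.inl ℝ E ℝ)) x₀ := by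
  have hev := eventually_forall_contDiffAt (by simp) hF
  have hd : ∀ t ∈ Icc (0 : ℝ) 1,
      ContinuousAt (fun q => (fderiv ℝ F q).comp (ContinuousLinearMap.inl ℝ E ℝ)) (x₀, t) := by
    intro t ht
    exact ((hF t ht).fderiv_right (m := 0) (by simp)).continuousAt.clm_comp continuousAt_const
  have hsl := continuousOn_slice hd
  obtain ⟨C, hC⟩ := isCompact_uIcc.exists_bound_of_continuousOn hsl
  -- The strict bound `C + 1` holds along the slice at `x₀` and is an open condition; compactness of
  -- `[0,1]` makes one neighbourhood of `x₀` serve all `t`.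
  have hb : ∀ᶠ x in 𝓝 x₀, ∀ t ∈ Icc (0 : ℝ) 1,
      ‖(fderiv ℝ F (x, t)).comp (ContinuousLinearMap.inl ℝ E ℝ)‖ < C + 1 := by
    refine isCompact_Icc.eventually_forall_of_forall_eventually fun t ht => ?_
    refine (hd t ht).norm.eventually_lt continuousAt_const ?_
    have := hC t (by rwa [uIcc_of_le zero_le_one])
    linarith
  have hsub : uIoc (0 : ℝ) 1 ⊆ Icc 0 1 := by
    rw [uIoc_of_le zero_le_one]; exact Ioc_subset_Icc_self
  have hs := hev.and hb
  refine intervalIntegral.hasFDerivAt_integral_of_dominated_of_fderiv_le (μ := volume)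
    (F := fun x t => F (x, t))
    (F' := fun x t => (fderiv ℝ F (x, t)).comp (ContinuousLinearMap.inl ℝ E ℝ))
    (bound := fun _ => C + 1) hs ?_ ?_ ?_ ?_ ?_ ?_
  · filter_upwards [hev] with x hx
    exact (continuousOn_slice fun t ht => (hx t ht).continuousAt).intervalIntegrable
      |>.aestronglyMeasurable_restrict_uIoc
  · exact (continuousOn_slice fun t ht => (hF t ht).continuousAt).intervalIntegrable
  · exact hsl.intervalIntegrable.aestronglyMeasurable_restrict_uIoc
  · exact ae_of_all _ fun t ht x hx => (hx.2 t (hsub ht)).le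
  · exact intervalIntegrable_const
  · refine ae_of_all _ fun t ht x hx => ?_
    have h1 := ((hx.1 t (hsub ht)).differentiableAt (by simp)).hasFDerivAt
    exact h1.comp (f := fun x => (x, t)) x (hasFDerivAt_prodMk_left x t)

end ParametricIntegral

universe u

/-- Induction on the order, passing from `F` to its partial derivative in the parameter. The target
becomes `E →L[ℝ] V`, which is why `V` is generalised and shares the universe of `E`. One order is
given up because domination comes from continuity of the next derivative. -/
theorem contDiffAt_integral_slice {E : Type u} [NormedAddCommGroup E] [NormedSpace ℝ E] (k : ℕ) :
    ∀ {V : Type u} [NormedAddCommGroup V] [NormedSpace ℝ V] {F : E × ℝ → V} {x₀ : E},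
    (∀ t ∈ Icc (0 : ℝ) 1, ContDiffAt ℝ (k + 1 : ℕ) F (x₀, t)) →
    ContDiffAt ℝ k (fun x => ∫ t in (0 : ℝ)..1, F (x, t)) x₀ := by
  induction k with
  | zero =>
    intro V _ _ F x₀ hF
    have hev := eventually_forall_contDiffAt (by simp) hF
    rw [Nat.cast_zero, contDiffAt_zero]
    refine ⟨_, hev, fun x hx => ?_⟩
    exact (hasFDerivAt_integral_slice (by simpa using hx)).continuousAt.continuousWithinAt
  | succ k ih =>
    intro V _ _ F x₀ hF
    have hev := eventually_forall_contDiffAt (by simp) hF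
    rw [Nat.cast_add, Nat.cast_one, contDiffAt_succ_iff_hasFDerivAt]
    refine ⟨fun x => ∫ t in (0 : ℝ)..1,
      (fderiv ℝ F (x, t)).comp (ContinuousLinearMap.inl ℝ E ℝ), ⟨_, hev, fun x hx => ?_⟩, ?_⟩
    · refine hasFDerivAt_integral_slice fun t ht => (hx t ht).of_le ?_
      norm_cast; omega
    · refine ih (F := fun q => (fderiv ℝ F q).comp (ContinuousLinearMap.inl ℝ E ℝ))
        fun t ht => ?_
      exact ((hF t ht).fderiv_right (m := (k + 1 : ℕ)) (by norm_cast)).clm_comp contDiffAt_const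

theorem contDiff_integral_slice {E V : Type u} [NormedAddCommGroup E] [NormedSpace ℝ E]
    [NormedAddCommGroup V] [NormedSpace ℝ V] {F : E × ℝ → V} (hF : ContDiff ℝ ∞ F) :
    ContDiff ℝ ∞ (fun x => ∫ t in (0 : ℝ)..1, F (x, t)) := by
  rw [contDiff_infty]
  intro k
  rw [contDiff_iff_contDiffAt]
  intro x
  exact contDiffAt_integral_slice k fun t _ => (contDiff_infty.1 hF _).contDiffAt

theorem hasDerivAt_slice {V : Type*} [NormedAddCommGroup V] [NormedSpace ℝ V] {K : ℝ × ℝ → V}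
    {s t : ℝ} (hK : ContDiffAt ℝ 1 K (s, t)) :
    HasDerivAt (fun s => K (s, t)) (fderiv ℝ K (s, t) (1, 0)) s := by
  have h1 := (hK.differentiableAt (by simp)).hasFDerivAt
  exact h1.comp_hasDerivAt s ((hasDerivAt_id s).prodMk (hasDerivAt_const s t))

theorem hasDerivAt_integral_slice {K : ℝ × ℝ → ℝ} {s : ℝ}
    (hK : ∀ t ∈ Icc (0 : ℝ) 1, ContDiffAt ℝ 1 K (s, t)) :
    HasDerivAt (fun s => ∫ t in (0 : ℝ)..1, K (s, t))
      (∫ t in (0 : ℝ)..1, fderiv ℝ K (s, t) (1, 0)) s := by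
  have h := (hasFDerivAt_integral_slice hK).hasDerivAt
  have hi : IntervalIntegrable
      (fun t => (fderiv ℝ K (s, t)).comp (ContinuousLinearMap.inl ℝ ℝ ℝ)) volume 0 1 :=
    (continuousOn_slice (F := fun q => (fderiv ℝ K q).comp (ContinuousLinearMap.inl ℝ ℝ ℝ))
      fun t ht => ((hK t ht).fderiv_right (m := 0) (by simp)).continuousAt.clm_comp
        continuousAt_const).intervalIntegrable
  rw [ContinuousLinearMap.intervalIntegral_apply hi] at h
  simpa using h

theorem deriv_integral_slice {K : ℝ × ℝ → ℝ} {s : ℝ}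
    (hK : ∀ t ∈ Icc (0 : ℝ) 1, ContDiffAt ℝ 1 K (s, t)) :
    deriv (fun s => ∫ t in (0 : ℝ)..1, K (s, t)) s =
      ∫ t in (0 : ℝ)..1, deriv (fun s => K (s, t)) s := by
  rw [(hasDerivAt_integral_slice hK).deriv]
  refine intervalIntegral.integral_congr fun t ht => ?_
  rw [uIcc_of_le zero_le_one] at ht
  exact (hasDerivAt_slice (hK t ht)).deriv.symm

theorem deriv_deriv_integral_slice {K : ℝ × ℝ → ℝ} {s₀ : ℝ}
    (hK : ∀ t ∈ Icc (0 : ℝ) 1, ContDiffAt ℝ 2 K (s₀, t)) :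
    deriv (deriv fun s => ∫ t in (0 : ℝ)..1, K (s, t)) s₀ =
      ∫ t in (0 : ℝ)..1, deriv (deriv fun s => K (s, t)) s₀ := by
  have hev := eventually_forall_contDiffAt (by decide) hK
  have h1 : deriv (fun s => ∫ t in (0 : ℝ)..1, K (s, t)) =ᶠ[𝓝 s₀]
      fun s => ∫ t in (0 : ℝ)..1, fderiv ℝ K (s, t) (1, 0) := by
    filter_upwards [hev] with s hs
    exact (hasDerivAt_integral_slice fun t ht => (hs t ht).of_le (by norm_num)).deriv
  rw [h1.deriv_eq, deriv_integral_slice (K := fun q => fderiv ℝ K q (1, 0))]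
  · refine intervalIntegral.integral_congr fun t ht => ?_
    rw [uIcc_of_le zero_le_one] at ht
    refine Filter.EventuallyEq.deriv_eq ?_
    filter_upwards [hev] with s hs
    exact (hasDerivAt_slice ((hs t ht).of_le (by norm_num))).deriv.symm
  · intro t ht
    exact ((hK t ht).fderiv_right (m := 1) (by norm_num)).clm_apply contDiffAt_const

/-! ### Second order conditions: the calibration inequality near the ray, and local minima. -/

/-- Second order comparison, near `y = 0`, of the squared conformal factor with the squared gradient
of the calibrating function, in the slope coordinate `y` orthogonal to the ray. -/
theorem eventually_calibration_le (p M : ℕ) (lam T m : ℝ) (hm : 0 ≤ m)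
    (hcrit : p * (lam ^ 2 - 1) * 2 = M * (1 + lam ^ 2 * T ^ 2))
    (hst : 0 < p * ((2 * T ^ 2 + 2 * lam ^ 2) / (1 + lam ^ 2 * T ^ 2) -
      4 * T ^ 2 * (lam ^ 2 - 1) ^ 2 / (1 + lam ^ 2 * T ^ 2) ^ 2) - M * T ^ 2 + m ^ 2 / 2) :
    ∀ᶠ y in 𝓝 (0 : ℝ),
      (1 + lam ^ 2 * T ^ 2) ^ p / (m + 2) ^ 2 *
        (((m + 2) + -((m + 2) * m) / 4 * m * y ^ 2) ^ 2 + 4 * (-((m + 2) * m) / 4) ^ 2 * y ^ 2) ≤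
      ((1 - T * y) ^ 2 + lam ^ 2 * (T + y) ^ 2) ^ p * (1 - T * y) ^ M := by
  set A := 1 + lam ^ 2 * T ^ 2 with hA
  have hA0 : 0 < A := by positivity
  -- This `b` minimises `4 (m + 2) m b + 8 b ^ 2`, the second derivative at `0` of the squared
  -- gradient before scaling by `C`. After scaling, the minimum is `-m ^ 2 / 2` times `A ^ p`, which
  -- is the Hardy term `m ^ 2 / 2` in `hst`.
  set b := -((m + 2) * m) / 4 with hb
  set C := A ^ p / (m + 2) ^ 2 with hC
  let q : ℝ → ℝ := fun y => (1 - T * y) ^ 2 + lam ^ 2 * (T + y) ^ 2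
  let q' : ℝ → ℝ := fun y => 2 * (1 - T * y) * (-T) + lam ^ 2 * (2 * (T + y))
  let l : ℝ → ℝ := fun y => 1 - T * y
  let g : ℝ → ℝ := fun y => q y ^ p * l y ^ M
  -- The logarithmic derivative of `g`. It vanishes at `0` by `hcrit`, so `g'' (0) = g (0) L' (0)`.
  let L : ℝ → ℝ := fun y => p * (q' y / q y) + M * (-T / l y)
  let P : ℝ → ℝ := fun y => C * (((m + 2) + b * m * y ^ 2) ^ 2 + 4 * b ^ 2 * y ^ 2)
  let P' : ℝ → ℝ := fun y => C * (2 * ((m + 2) + b * m * y ^ 2) * (b * m * (2 * y)) +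
    4 * b ^ 2 * (2 * y))
  have hl : ∀ y, HasDerivAt l (-T) y := fun y => by
    simpa using ((hasDerivAt_id y).const_mul T).const_sub 1
  have hq : ∀ y, HasDerivAt q (q' y) y := fun y => by
    have h1 := ((hl y).fun_pow 2).fun_add ((((hasDerivAt_id y).const_add T).fun_pow 2).const_mul
      (lam ^ 2))
    refine h1.congr_deriv ?_
    simp [q', l]
  have hq' : HasDerivAt q' (2 * T ^ 2 + 2 * lam ^ 2) 0 := by
    have h1 := (((hl 0).const_mul 2).mul_const (-T)).fun_add
      ((((hasDerivAt_id (0 : ℝ)).const_add T).const_mul 2).const_mul (lam ^ 2))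
    refine h1.congr_deriv ?_
    ring
  have hq0 : q 0 = A := by simp [q, hA]
  have hl0 : l 0 = 1 := by simp [l]
  have hq'0 : q' 0 = 2 * T * (lam ^ 2 - 1) := by simp only [q']; ring
  have hg : ∀ y, q y ≠ 0 → l y ≠ 0 → HasDerivAt g (g y * L y) y := fun y h1 h2 => by
    refine (((hq y).fun_pow p).fun_mul ((hl y).fun_pow M)).congr_deriv ?_
    simp only [g, L]
    rcases p with _ | p <;> rcases M with _ | M
    · simp
    · simp; field_simp; ring
    · simp; field_simp; ring
    · simp only [Nat.add_sub_cancel]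
      field_simp
      ring
  have hP : ∀ y, HasDerivAt P (P' y) y := fun y => by
    have h1 : HasDerivAt (fun y : ℝ => y ^ 2) (2 * y) y := by simpa using hasDerivAt_pow 2 y
    have h2 := ((((h1.const_mul (b * m)).const_add (m + 2)).fun_pow 2).fun_add
      (h1.const_mul (4 * b ^ 2))).const_mul C
    refine h2.congr_deriv ?_
    simp only [P']; norm_num
  have hP' : HasDerivAt P' (C * (4 * (m + 2) * (b * m) + 8 * b ^ 2)) 0 := by
    have h0 := (hasDerivAt_id (0 : ℝ)).const_mul 2
    have h1 : HasDerivAt (fun y : ℝ => y ^ 2) (2 * 0) 0 := by simpa using hasDerivAt_pow 2 (0 : ℝ)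
    have h2 := (((((h1.const_mul (b * m)).const_add (m + 2)).const_mul 2).fun_mul
      (h0.const_mul (b * m))).fun_add (h0.const_mul (4 * b ^ 2))).const_mul C
    refine h2.congr_deriv ?_
    simp only [id]; ring
  have hL0 : L 0 = 0 := by
    simp only [L, hq0, hl0, hq'0]
    field_simp
    linear_combination T * hcrit
  have hL : HasDerivAt L (p * ((2 * T ^ 2 + 2 * lam ^ 2) / A -
      4 * T ^ 2 * (lam ^ 2 - 1) ^ 2 / A ^ 2) - M * T ^ 2) 0 := by
    have h1 := ((hq'.fun_div (hq 0) (by rw [hq0]; exact hA0.ne')).const_mul (p : ℝ)).fun_add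
      (((hasDerivAt_const (0 : ℝ) (-T)).fun_div (hl 0) (by rw [hl0]; simp)).const_mul (M : ℝ))
    refine h1.congr_deriv ?_
    rw [hq0, hq'0, hl0]
    field_simp
    ring
  have hg0 : g 0 = A ^ p := by simp [g, hq0, hl0]
  have hnear : ∀ᶠ y in 𝓝 (0 : ℝ), q y ≠ 0 ∧ l y ≠ 0 :=
    ((hq 0).continuousAt.eventually_ne (by rw [hq0]; exact hA0.ne')).and
      ((hl 0).continuousAt.eventually_ne (by rw [hl0]; simp))
  have hd : deriv (fun y => g y - P y) =ᶠ[𝓝 0] fun y => g y * L y - P' y := by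
    filter_upwards [hnear] with y hy
    exact ((hg y hy.1 hy.2).fun_sub (hP y)).deriv
  have hg1 := hg 0 hnear.self_of_nhds.1 hnear.self_of_nhds.2
  have hdd : deriv (deriv (fun y => g y - P y)) 0 = A ^ p * (p * ((2 * T ^ 2 + 2 * lam ^ 2) / A -
      4 * T ^ 2 * (lam ^ 2 - 1) ^ 2 / A ^ 2) - M * T ^ 2 + m ^ 2 / 2) := by
    rw [hd.deriv_eq, ((hg1.fun_mul hL).fun_sub hP').deriv, hL0, hg0, hC, hb]
    have : m + 2 ≠ 0 := by positivity
    field_simp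
    ring
  have hmin := isLocalMin_of_deriv_deriv_pos (f := fun y => g y - P y) (x₀ := 0)
    (by rw [hdd]; positivity) (by rw [hd.self_of_nhds]; simp only [hL0]; simp [P'])
    (hg1.continuousAt.sub (hP 0).continuousAt)
  filter_upwards [hmin] with y hy
  have hP0 : P 0 = A ^ p := by
    simp only [P, hC]
    have : m + 2 ≠ 0 := by positivity
    field_simp
    ring
  simp only [hg0, hP0, sub_self] at hy
  exact sub_nonneg.1 hy

/-- Second order necessary condition at a local minimum. -/
theorem deriv_deriv_nonneg_of_isLocalMin {f : ℝ → ℝ} {x : ℝ} (hf : ContinuousAt f x)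
    (hmin : IsLocalMin f x) : 0 ≤ deriv (deriv f) x := by
  by_contra! h
  -- A negative second derivative would make the point a local maximum as well, so `f` would be
  -- locally constant and the second derivative zero.
  have hmax := isLocalMax_of_deriv_deriv_neg h hmin.deriv_eq_zero hf
  have hc : f =ᶠ[𝓝 x] fun _ => f x := by
    filter_upwards [hmin, hmax] with y h1 h2
    exact le_antisymm h2 h1
  have h2 := hc.deriv.deriv_eq
  simp at h2
  linarith

/-! ### Variations through the origin and division by `t`. -/

section Variations

/-- The velocity `∂Γ/∂t` of a variation. -/
def velocity (Γ : ℝ × ℝ → ℝ × ℝ) (q : ℝ × ℝ) : ℝ × ℝ := fderiv ℝ Γ q (0, 1)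

variable {Γ H : ℝ × ℝ → ℝ × ℝ} {e : ℝ × ℝ}

theorem contDiff_velocity (hΓ : ContDiff ℝ ∞ Γ) : ContDiff ℝ ∞ (velocity Γ) :=
  (hΓ.fderiv_right (m := ∞) (by simp)).clm_apply contDiff_const

theorem hasDerivAt_velocity (hΓ : ContDiff ℝ ∞ Γ) (s t : ℝ) :
    HasDerivAt (fun t => Γ (s, t)) (velocity Γ (s, t)) t :=
  ((hΓ.differentiable (by simp) (s, t)).hasFDerivAt).comp_hasDerivAt t
    ((hasDerivAt_const t s).prodMk (hasDerivAt_id t))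

theorem velocity_eq_of_linear (hΓ : ContDiff ℝ ∞ Γ)
    (hbase : ∀ t ∈ Icc (0 : ℝ) 1, Γ (0, t) = t • e) {t : ℝ} (ht : t ∈ Icc (0 : ℝ) 1) :
    velocity Γ (0, t) = e := by
  have h1 := (hasDerivAt_velocity hΓ 0 t).hasDerivWithinAt (s := Icc 0 1)
  -- The base curve is prescribed on `[0,1]` only, so at the endpoints the derivative is identified
  -- from one side.
  have h2 : HasDerivWithinAt (fun t => Γ (0, t)) ((1 : ℝ) • e) (Icc 0 1) t :=
    (((hasDerivAt_id t).smul_const e).hasDerivWithinAt).congr hbase (hbase t ht)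
  simpa using (uniqueDiffOn_Icc zero_lt_one t ht).eq_deriv _ h1 h2

/-- A variation that fixes the origin at `t = 0` is `t` times a smooth map. -/
theorem exists_smooth_quotient (hΓ : ContDiff ℝ ∞ Γ) (h0 : ∀ s, Γ (s, 0) = 0)
    (hbase : ∀ t ∈ Icc (0 : ℝ) 1, Γ (0, t) = t • e) :
    ∃ H : ℝ × ℝ → ℝ × ℝ, ContDiff ℝ ∞ H ∧ (∀ s t, Γ (s, t) = t • H (s, t)) ∧
      ∀ t ∈ Icc (0 : ℝ) 1, H (0, t) = e := by
  -- Hadamard's formula: the mean of the velocity over `[0, t]` is smooth across `t = 0` and equals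
  -- `Γ / t` elsewhere.
  refine ⟨fun q => ∫ u in (0 : ℝ)..1, velocity Γ (q.1, q.2 * u), ?_, fun s t => ?_, fun t ht => ?_⟩
  · exact contDiff_integral_slice (E := ℝ × ℝ) (V := ℝ × ℝ)
      (F := fun x => velocity Γ (x.1.1, x.1.2 * x.2)) ((contDiff_velocity hΓ).comp (by fun_prop))
  · have hd : ∀ u ∈ uIcc (0 : ℝ) 1,
        HasDerivAt (fun u => Γ (s, t * u)) (t • velocity Γ (s, t * u)) u := fun u _ => by
      have h : HasDerivAt (fun u => Γ (s, t * u)) ((t * 1) • velocity Γ (s, t * u)) u :=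
        (hasDerivAt_velocity hΓ s (t * u)).scomp u ((hasDerivAt_id u).const_mul t)
      rwa [mul_one] at h
    have hc : Continuous fun u : ℝ => t • velocity Γ (s, t * u) :=
      ((contDiff_velocity hΓ).continuous.comp (by fun_prop)).const_smul t
    have := intervalIntegral.integral_eq_sub_of_hasDerivAt hd (hc.intervalIntegrable 0 1)
    rw [intervalIntegral.integral_smul] at this
    simpa [h0] using this.symm
  · have : ∀ u ∈ uIcc (0 : ℝ) 1, velocity Γ ((0, t).1, (0, t).2 * u) = e := fun u hu => by
      rw [uIcc_of_le zero_le_one] at hu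
      exact velocity_eq_of_linear hΓ hbase ⟨mul_nonneg ht.1 hu.1, mul_le_one₀ ht.2 hu.1 hu.2⟩
    change ∫ u in (0 : ℝ)..1, velocity Γ ((0, t).1, (0, t).2 * u) = e
    rw [intervalIntegral.integral_congr (g := fun _ => e) this]
    simp

end Variations

/-! ### The length density and the calibrating form. -/

/-- The square of the (homogeneous) length integrand `√(metric)`, without the factor `σ₀²`. -/
def densitySq (n p : ℕ) (lam : ℝ) (h v : ℝ × ℝ) : ℝ :=
  (h.1 ^ 2 + lam ^ 2 * h.2 ^ 2) ^ p * h.1 ^ (2 * (n - p)) * (v.1 ^ 2 + v.2 ^ 2)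

/-- The differential at `h` of the calibrating function `c (X ^ (k + 3) + b X ^ (k + 1) Y ^ 2)`,
where `X = h₁ + T h₂` and `Y = h₂ - T h₁`, applied to `v`. -/
def calibrationForm (k : ℕ) (T b c : ℝ) (h v : ℝ × ℝ) : ℝ :=
  c * (((k + 3) * (h.1 + T * h.2) ^ (k + 2) +
      b * (k + 1) * (h.1 + T * h.2) ^ k * (h.2 - T * h.1) ^ 2) * (v.1 + T * v.2) +
    2 * b * (h.1 + T * h.2) ^ (k + 1) * (h.2 - T * h.1) * (v.2 - T * v.1))

theorem calibrationForm_smul (k : ℕ) (T b c t : ℝ) (h v : ℝ × ℝ) :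
    calibrationForm k T b c (t • h) v = t ^ (k + 2) * calibrationForm k T b c h v := by
  simp only [calibrationForm, Prod.smul_fst, Prod.smul_snd, smul_eq_mul]
  have e1 : t * h.1 + T * (t * h.2) = t * (h.1 + T * h.2) := by ring
  have e2 : t * h.2 - T * (t * h.1) = t * (h.2 - T * h.1) := by ring
  rw [e1, e2]
  simp only [mul_pow]
  ring

/-- Homogeneity removes the factor in `X` and reduces the comparison to the slope `y = Y / X`, where
it is the hypothesis `hy`. The direction of `v` is handled by Cauchy–Schwarz in the frame `v₁ + T
v₂`, `v₂ - T v₁`, whose squares sum to `(1 + T ^ 2) |v| ^ 2`. The constant makes both sides equal at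
`h = v = (1, T)`. -/
theorem calibrationForm_le {n p k : ℕ} {lam T b : ℝ} {h v : ℝ × ℝ} (hn : n = k + 2) (hpn : p ≤ n)
    (hX : 0 < h.1 + T * h.2)
    (hy : (1 + lam ^ 2 * T ^ 2) ^ p / ((k + 1 : ℝ) + 2) ^ 2 *
        ((((k + 1 : ℝ) + 2) + b * (k + 1) * ((h.2 - T * h.1) / (h.1 + T * h.2)) ^ 2) ^ 2 +
          4 * b ^ 2 * ((h.2 - T * h.1) / (h.1 + T * h.2)) ^ 2) ≤
      ((1 - T * ((h.2 - T * h.1) / (h.1 + T * h.2))) ^ 2 +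
        lam ^ 2 * (T + (h.2 - T * h.1) / (h.1 + T * h.2)) ^ 2) ^ p *
        (1 - T * ((h.2 - T * h.1) / (h.1 + T * h.2))) ^ (2 * (n - p))) :
    calibrationForm k T b (√((1 + lam ^ 2 * T ^ 2) ^ p * (1 + T ^ 2)) /
      ((k + 3) * (1 + T ^ 2) ^ (k + 3))) h v ≤ √(densitySq n p lam h v) := by
  obtain ⟨h1, h2⟩ := h
  obtain ⟨v1, v2⟩ := v
  simp only at hX hy
  apply Real.le_sqrt_of_sq_le
  simp only [calibrationForm, densitySq]
  set S := 1 + T ^ 2 with hS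
  have hS0 : 0 < S := by positivity
  set G := (1 + lam ^ 2 * T ^ 2) ^ p with hG
  have hG0 : 0 ≤ G := by positivity
  set X := h1 + T * h2 with hXdef
  set y := (h2 - T * h1) / X with hydef
  have hY : h2 - T * h1 = y * X := by rw [hydef]; field_simp
  have e1 : h1 = X * (1 - T * y) / S := by
    rw [eq_div_iff hS0.ne']; linear_combination -T * hY - hXdef + h1 * hS
  have e2 : h2 = X * (T + y) / S := by
    rw [eq_div_iff hS0.ne']; linear_combination hY - T * hXdef + h2 * hS
  rw [hY]
  have hM : p + (n - p) = n := by omega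
  have hdens : (h1 ^ 2 + lam ^ 2 * h2 ^ 2) ^ p * h1 ^ (2 * (n - p)) =
      (X / S) ^ (2 * n) * (((1 - T * y) ^ 2 + lam ^ 2 * (T + y) ^ 2) ^ p *
        (1 - T * y) ^ (2 * (n - p))) := by
    have e3 : h1 ^ 2 + lam ^ 2 * h2 ^ 2 =
        (X / S) ^ 2 * ((1 - T * y) ^ 2 + lam ^ 2 * (T + y) ^ 2) := by
      rw [e1, e2]; field_simp
    have e4 : h1 = (X / S) * (1 - T * y) := by rw [e1]; ring
    have e5 : (X / S) ^ (2 * n) = (X / S) ^ (2 * p) * (X / S) ^ (2 * (n - p)) := by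
      rw [← pow_add, ← mul_add, hM]
    have e6 : h1 ^ (2 * (n - p)) = (X / S) ^ (2 * (n - p)) * (1 - T * y) ^ (2 * (n - p)) := by
      rw [← mul_pow, ← e4]
    rw [e3, mul_pow, e5, e6, ← pow_mul]
    ring
  rw [hdens]
  set R := ((1 - T * y) ^ 2 + lam ^ 2 * (T + y) ^ 2) ^ p * (1 - T * y) ^ (2 * (n - p)) with hR
  have hcs : ((((k : ℝ) + 3) + b * (k + 1) * y ^ 2) * (v1 + T * v2) +
      2 * b * y * (v2 - T * v1)) ^ 2 ≤
      ((((k : ℝ) + 3) + b * (k + 1) * y ^ 2) ^ 2 + 4 * b ^ 2 * y ^ 2) *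
        (S * (v1 ^ 2 + v2 ^ 2)) := by
    have e : ∀ a d : ℝ, (a * (v1 + T * v2) + d * (v2 - T * v1)) ^ 2 ≤
        (a ^ 2 + d ^ 2) * (S * (v1 ^ 2 + v2 ^ 2)) := fun a d => by
      have := sq_nonneg (a * (v2 - T * v1) - d * (v1 + T * v2))
      rw [hS]
      linarith
    refine (e _ _).trans_eq ?_
    ring
  have hk : (k : ℝ) + 1 + 2 = k + 3 := by ring
  rw [hk] at hy
  have hk3 : (0 : ℝ) < k + 3 := by positivity
  have hsq : (√(G * S)) ^ 2 = G * S := Real.sq_sqrt (by positivity)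
  clear_value S G X y R
  calc _ = (√(G * S)) ^ 2 / ((k + 3) * S ^ (k + 3)) ^ 2 * X ^ (2 * (k + 2)) *
        ((((k : ℝ) + 3) + b * (k + 1) * y ^ 2) * (v1 + T * v2) + 2 * b * y * (v2 - T * v1)) ^ 2 := by
        rw [← div_pow]
        generalize √(G * S) / ((k + 3) * S ^ (k + 3)) = c
        ring
    _ ≤ (√(G * S)) ^ 2 / ((k + 3) * S ^ (k + 3)) ^ 2 * X ^ (2 * (k + 2)) *
        (((((k : ℝ) + 3) + b * (k + 1) * y ^ 2) ^ 2 + 4 * b ^ 2 * y ^ 2) *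
        (S * (v1 ^ 2 + v2 ^ 2))) := by gcongr
    _ = (X / S) ^ (2 * n) * (G / (k + 3) ^ 2 *
        ((((k : ℝ) + 3) + b * (k + 1) * y ^ 2) ^ 2 + 4 * b ^ 2 * y ^ 2)) * (v1 ^ 2 + v2 ^ 2) := by
        rw [hsq, hn]
        generalize (((k : ℝ) + 3) + b * (k + 1) * y ^ 2) ^ 2 + 4 * b ^ 2 * y ^ 2 = Z
        have e5 : ((k + 3) * S ^ (k + 3)) ^ 2 = (k + 3 : ℝ) ^ 2 * (S ^ (2 * (k + 2)) * S ^ 2) := by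
          ring
        rw [e5, div_pow]
        generalize S ^ (2 * (k + 2)) = U at *
        field_simp
    _ ≤ _ := by gcongr

section RayVariations

variable {Γ H : ℝ × ℝ → ℝ × ℝ} {T : ℝ}

/-- The conformal factor is homogeneous of degree `2 n`, so `t ^ n` leaves the root and carries the
whole degeneracy at the origin; what remains is positive on the segment. -/
theorem variationLength_eq {n p : ℕ} {lam : ℝ} (hpn : p ≤ n) (hΓ : ContDiff ℝ ∞ Γ)
    (hΓH : ∀ s t, Γ (s, t) = t • H (s, t)) (s : ℝ) :
    variationLength n p lam Γ s = sphereVolume n *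
      ∫ t in (0 : ℝ)..1, t ^ n * √(densitySq n p lam (H (s, t)) (velocity Γ (s, t))) := by
  rw [variationLength, orbitLength, ← intervalIntegral.integral_const_mul]
  refine intervalIntegral.integral_congr fun t ht => ?_
  rw [uIcc_of_le zero_le_one] at ht
  have hvol : 0 ≤ sphereVolume n := measureReal_nonneg
  have hd : deriv (fun t => Γ (s, t)) t = velocity Γ (s, t) := (hasDerivAt_velocity hΓ s t).deriv
  have hM : p + (n - p) = n := by omega
  have key : orbitMetric n p lam (Γ (s, t)) (velocity Γ (s, t)) (velocity Γ (s, t)) =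
      (sphereVolume n * t ^ n) ^ 2 * densitySq n p lam (H (s, t)) (velocity Γ (s, t)) := by
    rw [hΓH s t]
    simp only [orbitMetric, densitySq, Prod.smul_fst, Prod.smul_snd, smul_eq_mul]
    have e : (t * (H (s, t)).1) ^ 2 + lam ^ 2 * (t * (H (s, t)).2) ^ 2 =
      t ^ 2 * ((H (s, t)).1 ^ 2 + lam ^ 2 * (H (s, t)).2 ^ 2) := by ring
    have e' : (sphereVolume n * t ^ n) ^ 2 =
        sphereVolume n ^ 2 * (t ^ (2 * p) * t ^ (2 * (n - p))) := by
      rw [← pow_add, ← mul_add, hM]; ring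
    rw [e, e', mul_pow, mul_pow]
    ring
  simp only [hd]
  rw [key, Real.sqrt_mul (sq_nonneg _),
    Real.sqrt_sq (mul_nonneg hvol (pow_nonneg ht.1 _)), mul_assoc]

/-- The form is exact and both endpoints are fixed, so its integral is the difference of the
calibrating function at `(1, T)` and at `0`, independent of `s`. -/
theorem integral_calibrationForm {k : ℕ} (b c : ℝ) (hΓ : ContDiff ℝ ∞ Γ)
    (hΓH : ∀ s t, Γ (s, t) = t • H (s, t)) (h1 : ∀ s, Γ (s, 1) = (1, T)) (s : ℝ) :
    ∫ t in (0 : ℝ)..1, t ^ (k + 2) * calibrationForm k T b c (H (s, t)) (velocity Γ (s, t)) =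
      c * (1 + T ^ 2) ^ (k + 3) := by
  have hd : ∀ t ∈ uIcc (0 : ℝ) 1, HasDerivAt
      (fun t => c * (((Γ (s, t)).1 + T * (Γ (s, t)).2) ^ (k + 3) +
        b * (((Γ (s, t)).1 + T * (Γ (s, t)).2) ^ (k + 1) *
          ((Γ (s, t)).2 - T * (Γ (s, t)).1) ^ 2)))
      (calibrationForm k T b c (Γ (s, t)) (velocity Γ (s, t))) t := fun t _ => by
    have h := hasDerivAt_velocity hΓ s t
    have hf : HasDerivAt (fun t => (Γ (s, t)).1) (velocity Γ (s, t)).1 t := h.fst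
    have hs : HasDerivAt (fun t => (Γ (s, t)).2) (velocity Γ (s, t)).2 t := h.snd
    have hX := hf.fun_add (hs.const_mul T)
    have hY := hs.fun_sub (hf.const_mul T)
    refine (((hX.fun_pow (k + 3)).fun_add
      (((hX.fun_pow (k + 1)).fun_mul (hY.fun_pow 2)).const_mul b)).const_mul c).congr_deriv ?_
    simp only [calibrationForm, show k + 1 - 1 = k by omega, show k + 3 - 1 = k + 2 by omega]
    push_cast
    ring
  have hc : Continuous fun t : ℝ => calibrationForm k T b c (Γ (s, t)) (velocity Γ (s, t)) := by
    have c1 := hΓ.continuous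
    have c2 := (contDiff_velocity hΓ).continuous
    unfold calibrationForm
    fun_prop
  have h := intervalIntegral.integral_eq_sub_of_hasDerivAt hd (hc.intervalIntegrable 0 1)
  have h0 : Γ (s, 0) = 0 := by simp [hΓH]
  rw [h0, h1] at h
  simp only [hΓH, calibrationForm_smul] at h
  rw [h]
  simp only [Prod.fst_zero, Prod.snd_zero]
  ring

theorem densitySq_ray (n p : ℕ) (lam T : ℝ) :
    densitySq n p lam (1, T) (1, T) = (1 + lam ^ 2 * T ^ 2) ^ p * (1 + T ^ 2) := by
  simp [densitySq]

theorem contDiffAt_density {n p : ℕ} {lam : ℝ} (hΓ : ContDiff ℝ ∞ Γ) (hH : ContDiff ℝ ∞ H)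
    {q : ℝ × ℝ} (hHq : H q = (1, T)) (hVq : velocity Γ q = (1, T)) :
    ContDiffAt ℝ ∞
      (fun q : ℝ × ℝ => q.2 ^ n * √(densitySq n p lam (H q) (velocity Γ q))) q := by
  have h1 : ContDiffAt ℝ ∞ (fun q => densitySq n p lam (H q) (velocity Γ q)) q := by
    have c1 := contDiff_fst.comp hH
    have c2 := contDiff_snd.comp hH
    have c3 := contDiff_fst.comp (contDiff_velocity hΓ)
    have c4 := contDiff_snd.comp (contDiff_velocity hΓ)
    unfold densitySq
    exact ContDiff.contDiffAt
      (((((c1.pow 2).add (contDiff_const.mul (c2.pow 2))).pow p).mul (c1.pow _)).mul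
        ((c3.pow 2).add (c4.pow 2)))
  refine (contDiff_snd.pow n).contDiffAt.mul (h1.sqrt ?_)
  rw [hHq, hVq, densitySq_ray]
  positivity

/-- First variation of the length integrand, compared with the exact form. -/
theorem hasDerivAt_density_sub_calibration {n p k : ℕ} {lam : ℝ} (hn : n = k + 2) (hpn : p ≤ n)
    (hcrit : p * (lam ^ 2 - 1) = ((n - p : ℕ) : ℝ) * (1 + lam ^ 2 * T ^ 2))
    {h v : ℝ → ℝ × ℝ} {h' v' : ℝ × ℝ} (hh : HasDerivAt h h' 0) (hv : HasDerivAt v v' 0)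
    (h0 : h 0 = (1, T)) (v0 : v 0 = (1, T)) :
    HasDerivAt (fun s => √(densitySq n p lam (h s) (v s)) -
      calibrationForm k T 0 (√((1 + lam ^ 2 * T ^ 2) ^ p * (1 + T ^ 2)) /
      ((k + 3) * (1 + T ^ 2) ^ (k + 3))) (h s) (v s)) 0 0 := by
  set A := 1 + lam ^ 2 * T ^ 2 with hA
  have hA0 : 0 < A := by positivity
  set S := 1 + T ^ 2 with hS
  have hS0 : 0 < S := by positivity
  have hh1 : HasDerivAt (fun s => (h s).1) h'.1 0 := hh.fst
  have hh2 : HasDerivAt (fun s => (h s).2) h'.2 0 := hh.snd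
  have hv1 : HasDerivAt (fun s => (v s).1) v'.1 0 := hv.fst
  have hv2 : HasDerivAt (fun s => (v s).2) v'.2 0 := hv.snd
  have hnp : ((n - p : ℕ) : ℝ) = n - p := by rw [Nat.cast_sub hpn]
  have hnk : (n : ℝ) = k + 2 := by rw [hn]; push_cast; ring
  have hW : HasDerivAt (fun s => densitySq n p lam (h s) (v s))
      (2 * A ^ p * (n * (h'.1 + T * h'.2) + (v'.1 + T * v'.2))) 0 := by
    refine (((((hh1.fun_pow 2).fun_add ((hh2.fun_pow 2).const_mul (lam ^ 2))).fun_pow p).fun_mul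
      (hh1.fun_pow (2 * (n - p)))).fun_mul ((hv1.fun_pow 2).fun_add (hv2.fun_pow 2))).congr_deriv ?_
    simp only [h0, v0, one_pow]
    rw [← hA, ← hS]
    rw [hnp] at hcrit
    push_cast
    rw [hnp]
    -- For `p = 0` the critical equation would read `0 = n A` with both factors nonzero.
    rcases p with _ | p
    · simp only [Nat.cast_zero, zero_mul, sub_zero, pow_zero] at hcrit ⊢
      have : (n : ℝ) ≠ 0 := by rw [hnk]; positivity
      have h2 : A = 0 := by
        rcases mul_eq_zero.1 hcrit.symm with h | h
        · exact absurd h this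
        · exact h
      exact absurd h2 hA0.ne'
    · simp only [Nat.add_sub_cancel, pow_succ A p]
      push_cast at hcrit ⊢
      -- Here the critical equation enters: it makes the gradient of the conformal factor at `(1,
      -- T)` parallel to the ray.
      have e : (((p : ℝ) + 1) * (h'.1 + lam ^ 2 * T * h'.2) * S +
          (n - (p + 1)) * h'.1 * S * A) = A * (n * (h'.1 + T * h'.2)) := by
        rw [hS, hA] at *
        linear_combination (-T ^ 2 * h'.1 + T * h'.2) * hcrit
      linear_combination 2 * A ^ p * e
  have hP : HasDerivAt (fun s => calibrationForm k T 0 (√(A ^ p * S) / ((k + 3) * S ^ (k + 3)))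
      (h s) (v s)) (√(A ^ p * S) / S * (n * (h'.1 + T * h'.2) + (v'.1 + T * v'.2))) 0 := by
    have e : ∀ s, calibrationForm k T 0 (√(A ^ p * S) / ((k + 3) * S ^ (k + 3))) (h s) (v s) =
        √(A ^ p * S) / S ^ (k + 3) *
          (((h s).1 + T * (h s).2) ^ (k + 2) * ((v s).1 + T * (v s).2)) := fun s => by
      have : (k : ℝ) + 3 ≠ 0 := by positivity
      simp only [calibrationForm]
      field_simp
      ring
    simp only [e]
    refine ((((hh1.fun_add (hh2.const_mul T)).fun_pow (k + 2)).fun_mul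
      (hv1.fun_add (hv2.const_mul T))).const_mul _).congr_deriv ?_
    simp only [h0, v0]
    rw [show 1 + T * T = S by rw [hS]; ring, hnk, show k + 2 - 1 = k + 1 by omega]
    push_cast
    field_simp
    ring
  have hW0 : densitySq n p lam (h 0) (v 0) = A ^ p * S := by rw [h0, v0, densitySq_ray]
  refine ((hW.sqrt (by rw [hW0]; positivity)).fun_sub hP).congr_deriv ?_
  rw [hW0]
  have hpos : 0 < A ^ p * S := by positivity
  have hsq : √(A ^ p * S) ^ 2 = A ^ p * S := Real.sq_sqrt hpos.le
  have hs0 : √(A ^ p * S) ≠ 0 := (Real.sqrt_pos.2 hpos).ne'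
  field_simp
  rw [hsq]
  ring

end RayVariations

/-! ### Length compared with the calibration: geodesic and stable cases. -/

section Segment

variable {θ : ℝ} {Γ : ℝ × ℝ → ℝ × ℝ}

theorem segmentOQ_eq_smul (θ t : ℝ) : segmentOQ θ t = t • ((1, Real.tan θ) : ℝ × ℝ) := by
  simp [segmentOQ]

theorem IsProperVariation.exists_quotient (hΓ : IsProperVariation (segmentOQ θ) Γ) :
    ∃ H : ℝ × ℝ → ℝ × ℝ, ContDiff ℝ ∞ H ∧ (∀ s t, Γ (s, t) = t • H (s, t)) ∧
      (∀ t ∈ Icc (0 : ℝ) 1, H (0, t) = (1, Real.tan θ)) ∧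
      ∀ t ∈ Icc (0 : ℝ) 1, velocity Γ (0, t) = (1, Real.tan θ) := by
  have hb : ∀ t ∈ Icc (0 : ℝ) 1, Γ (0, t) = t • ((1, Real.tan θ) : ℝ × ℝ) := fun t ht => by
    rw [hΓ.base t ht, segmentOQ_eq_smul]
  obtain ⟨H, h1, h2, h3⟩ := exists_smooth_quotient hΓ.contDiff
    (fun s => by rw [hΓ.left, segmentOQ_eq_smul, zero_smul]) hb
  exact ⟨H, h1, h2, h3, fun t ht => velocity_eq_of_linear hΓ.contDiff hb ht⟩

theorem contDiffAt_variationLength {n p : ℕ} (lam : ℝ) (hpn : p ≤ n)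
    (hΓ : IsProperVariation (segmentOQ θ) Γ) :
    ContDiffAt ℝ 2 (variationLength n p lam Γ) 0 := by
  obtain ⟨H, hH, hΓH, hH0, hV0⟩ := hΓ.exists_quotient
  rw [show variationLength n p lam Γ = _ from
    funext fun s => variationLength_eq (lam := lam) hpn hΓ.contDiff hΓH s]
  refine contDiffAt_const.mul (contDiffAt_integral_slice 2
    (F := fun q => q.2 ^ n * √(densitySq n p lam (H q) (velocity Γ q))) fun t ht => ?_)
  exact contDiffAt_infty.1 (contDiffAt_density hΓ.contDiff hH (hH0 t ht) (hV0 t ht)) _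

/-- The length integrand minus the exact form given by the calibrating function. -/
def lengthExcess (n p k : ℕ) (lam T b : ℝ) (Γ H : ℝ × ℝ → ℝ × ℝ) (q : ℝ × ℝ) : ℝ :=
  q.2 ^ n * √(densitySq n p lam (H q) (velocity Γ q)) -
    q.2 ^ (k + 2) * calibrationForm k T b (√((1 + lam ^ 2 * T ^ 2) ^ p * (1 + T ^ 2)) /
      ((k + 3) * (1 + T ^ 2) ^ (k + 3))) (H q) (velocity Γ q)

theorem contDiff_calibrationForm {H : ℝ × ℝ → ℝ × ℝ} (k : ℕ) (T b c : ℝ)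
    (hΓ : ContDiff ℝ ∞ Γ) (hH : ContDiff ℝ ∞ H) :
    ContDiff ℝ ∞ fun q => calibrationForm k T b c (H q) (velocity Γ q) := by
  have c1 := contDiff_fst.comp hH
  have c2 := contDiff_snd.comp hH
  have c3 := contDiff_fst.comp (contDiff_velocity hΓ)
  have c4 := contDiff_snd.comp (contDiff_velocity hΓ)
  simp only [Function.comp_def] at c1 c2 c3 c4
  unfold calibrationForm
  fun_prop

theorem contDiffAt_lengthExcess {H : ℝ × ℝ → ℝ × ℝ} {n p k : ℕ} {lam T b : ℝ}
    (hΓ : ContDiff ℝ ∞ Γ) (hH : ContDiff ℝ ∞ H) {q : ℝ × ℝ} (hHq : H q = (1, T))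
    (hVq : velocity Γ q = (1, T)) : ContDiffAt ℝ ∞ (lengthExcess n p k lam T b Γ H) q :=
  (contDiffAt_density hΓ hH hHq hVq).sub ((contDiff_snd.pow _).mul
    (contDiff_calibrationForm k T b _ hΓ hH)).contDiffAt

/-- The subtracted form has constant integral, so length and total excess differ by a constant up to
the factor `σ₀`. This replaces the variation of length by that of a quantity controlled pointwise in
`t`. -/
theorem eventually_variationLength_eq {H : ℝ × ℝ → ℝ × ℝ} {n p k : ℕ} {lam b : ℝ} (hpn : p ≤ n)
    (hΓ : IsProperVariation (segmentOQ θ) Γ) (hH : ContDiff ℝ ∞ H)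
    (hΓH : ∀ s t, Γ (s, t) = t • H (s, t))
    (hH0 : ∀ t ∈ Icc (0 : ℝ) 1, H (0, t) = (1, Real.tan θ))
    (hV0 : ∀ t ∈ Icc (0 : ℝ) 1, velocity Γ (0, t) = (1, Real.tan θ)) :
    ∃ c : ℝ, ∀ᶠ s in 𝓝 (0 : ℝ), variationLength n p lam Γ s = sphereVolume n *
      ((∫ t in (0 : ℝ)..1, lengthExcess n p k lam (Real.tan θ) b Γ H (s, t)) + c) := by
  have h1 : ∀ s, Γ (s, 1) = (1, Real.tan θ) := fun s => by
    rw [hΓ.right, segmentOQ_eq_smul, one_smul]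
  refine ⟨√((1 + lam ^ 2 * Real.tan θ ^ 2) ^ p * (1 + Real.tan θ ^ 2)) /
      ((k + 3) * (1 + Real.tan θ ^ 2) ^ (k + 3)) * (1 + Real.tan θ ^ 2) ^ (k + 3), ?_⟩
  have hev := eventually_forall_contDiffAt (F := fun q : ℝ × ℝ => q.2 ^ n *
    √(densitySq n p lam (H q) (velocity Γ q))) (x₀ := (0 : ℝ)) (k := 1) (by simp) fun t ht =>
      (contDiffAt_density hΓ.contDiff hH (hH0 t ht) (hV0 t ht)).of_le (by exact_mod_cast le_top)
  filter_upwards [hev] with s hs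
  rw [variationLength_eq hpn hΓ.contDiff hΓH]
  simp only [lengthExcess]
  have hi1 := (continuousOn_slice fun t ht => (hs t ht).continuousAt).intervalIntegrable
    (μ := volume)
  have hc : Continuous fun t : ℝ => t ^ (k + 2) * calibrationForm k (Real.tan θ) b
      (√((1 + lam ^ 2 * Real.tan θ ^ 2) ^ p * (1 + Real.tan θ ^ 2)) /
      ((k + 3) * (1 + Real.tan θ ^ 2) ^ (k + 3))) (H (s, t)) (velocity Γ (s, t)) :=
    (continuous_id.pow _).mul
      ((contDiff_calibrationForm k _ b _ hΓ.contDiff hH).continuous.comp (by fun_prop))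
  rw [intervalIntegral.integral_sub hi1 (hc.intervalIntegrable 0 1),
    integral_calibrationForm b _ hΓ.contDiff hΓH h1, sub_add_cancel]

/-- The `b` term is quadratic in the distance to the ray and plays no role to first order, so `b =
0` suffices: the excess then has zero derivative in `s` at every `t`. -/
theorem isOrbitGeodesic_segmentOQ {n p k : ℕ} {lam : ℝ} (hn : n = k + 2) (hpn : p ≤ n)
    (hcrit : p * (lam ^ 2 - 1) = ((n - p : ℕ) : ℝ) * (1 + lam ^ 2 * Real.tan θ ^ 2)) :
    IsOrbitGeodesic n p lam (segmentOQ θ) := by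
  intro Γ hΓ
  obtain ⟨H, hH, hΓH, hH0, hV0⟩ := hΓ.exists_quotient
  obtain ⟨c, hc⟩ := eventually_variationLength_eq (n := n) (p := p) (k := k) (lam := lam) (b := 0)
    hpn hΓ hH hΓH hH0 hV0
  have hE : ∀ t ∈ Icc (0 : ℝ) 1,
      ContDiffAt ℝ 1 (lengthExcess n p k lam (Real.tan θ) 0 Γ H) (0, t) := fun t ht =>
    (contDiffAt_lengthExcess hΓ.contDiff hH (hH0 t ht) (hV0 t ht)).of_le (by exact_mod_cast le_top)
  have hE' : ∀ t ∈ uIcc (0 : ℝ) 1,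
      fderiv ℝ (lengthExcess n p k lam (Real.tan θ) 0 Γ H) (0, t) (1, 0) = 0 := fun t ht => by
    rw [uIcc_of_le zero_le_one] at ht
    have hh := hasDerivAt_slice (hH.contDiffAt (x := ((0 : ℝ), t)) |>.of_le
      (mod_cast (le_top : ((1 : ℕ) : ℕ∞) ≤ ⊤)))
    have hv := hasDerivAt_slice ((contDiff_velocity hΓ.contDiff).contDiffAt (x := ((0 : ℝ), t))
      |>.of_le (mod_cast (le_top : ((1 : ℕ) : ℕ∞) ≤ ⊤)))
    have h := (hasDerivAt_density_sub_calibration hn hpn hcrit hh hv (hH0 t ht)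
      (hV0 t ht)).const_mul (t ^ n)
    refine (hasDerivAt_slice (hE t ht)).unique ?_
    rw [mul_zero] at h
    refine h.congr_of_eventuallyEq (Eventually.of_forall fun s => ?_)
    simp only [lengthExcess, ← hn]
    ring
  have h := hasDerivAt_integral_slice hE
  rw [intervalIntegral.integral_congr (g := fun _ => (0 : ℝ)) hE'] at h
  have h2 := (h.add_const c).const_mul (sphereVolume n)
  simp only [intervalIntegral.integral_zero, mul_zero] at h2
  exact h2.congr_of_eventuallyEq hc

/-- The excess is nonnegative near the segment and zero on it, so the length has a local minimum at
`s = 0`. No second variation has to be computed for a general `Γ`. -/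
theorem isStableCurve_segmentOQ {n p k : ℕ} {lam : ℝ} (hn : n = k + 2) (hpn : p ≤ n)
    (hcrit : p * (lam ^ 2 - 1) = ((n - p : ℕ) : ℝ) * (1 + lam ^ 2 * Real.tan θ ^ 2))
    (hst : 0 < p * ((2 * Real.tan θ ^ 2 + 2 * lam ^ 2) / (1 + lam ^ 2 * Real.tan θ ^ 2) -
      4 * Real.tan θ ^ 2 * (lam ^ 2 - 1) ^ 2 / (1 + lam ^ 2 * Real.tan θ ^ 2) ^ 2) -
      (2 * (n - p) : ℕ) * Real.tan θ ^ 2 + (k + 1 : ℝ) ^ 2 / 2) :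
    IsStableCurve n p lam (segmentOQ θ) := by
  intro Γ hΓ
  have hC := contDiffAt_variationLength (n := n) (p := p) lam hpn hΓ
  refine ⟨hC, deriv_deriv_nonneg_of_isLocalMin hC.continuousAt ?_⟩
  obtain ⟨H, hH, hΓH, hH0, hV0⟩ := hΓ.exists_quotient
  set T := Real.tan θ with hT
  set b : ℝ := -(((k + 1 : ℝ) + 2) * (k + 1)) / 4 with hb
  obtain ⟨c, hc⟩ := eventually_variationLength_eq (n := n) (p := p) (k := k) (lam := lam) (b := b)
    hpn hΓ hH hΓH hH0 hV0
  have hcal := eventually_calibration_le p (2 * (n - p)) lam T (k + 1) (by positivity)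
    (by push_cast; linear_combination 2 * hcrit) hst
  have hpos : ∀ᶠ s in 𝓝 (0 : ℝ), ∀ t ∈ Icc (0 : ℝ) 1,
      0 ≤ lengthExcess n p k lam T b Γ H (s, t) := by
    -- The slope is read from `H` and not from `Γ`, so it makes sense at `t = 0` too and is small
    -- uniformly in `t`.
    have hnear : ∀ᶠ s in 𝓝 (0 : ℝ), ∀ t ∈ Icc (0 : ℝ) 1,
        0 < (H (s, t)).1 + T * (H (s, t)).2 ∧
        calibrationForm k T b (√((1 + lam ^ 2 * T ^ 2) ^ p * (1 + T ^ 2)) /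
          ((k + 3) * (1 + T ^ 2) ^ (k + 3))) (H (s, t)) (velocity Γ (s, t)) ≤
          √(densitySq n p lam (H (s, t)) (velocity Γ (s, t))) := by
      refine isCompact_Icc.eventually_forall_of_forall_eventually fun t ht => ?_
      have hX : ContinuousAt (fun q => (H q).1 + T * (H q).2) (0, t) := by
        have := hH.continuous
        fun_prop
      have hX0 : 0 < (H (0, t)).1 + T * (H (0, t)).2 := by
        rw [hH0 t ht]
        have := mul_self_nonneg T
        change 0 < 1 + T * T
        linarith
      have hY : ContinuousAt (fun q => ((H q).2 - T * (H q).1) / ((H q).1 + T * (H q).2))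
          (0, t) := by
        refine ContinuousAt.div ?_ hX hX0.ne'
        have := hH.continuous
        fun_prop
      have hY0 : ((H (0, t)).2 - T * (H (0, t)).1) / ((H (0, t)).1 + T * (H (0, t)).2) = 0 := by
        rw [hH0 t ht]
        simp
      have hYt : Tendsto (fun q => ((H q).2 - T * (H q).1) / ((H q).1 + T * (H q).2))
          (𝓝 (0, t)) (𝓝 0) := by
        have := hY.tendsto
        rwa [hY0] at this
      filter_upwards [hX.eventually_const_lt hX0, hYt.eventually hcal] with q hq1 hq2
      exact ⟨hq1, calibrationForm_le hn hpn hq1 hq2⟩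
    filter_upwards [hnear] with s hs t ht
    simp only [lengthExcess, ← hn, ← mul_sub]
    exact mul_nonneg (pow_nonneg ht.1 _) (sub_nonneg.2 (hs t ht).2)
  have hzero : ∫ t in (0 : ℝ)..1, lengthExcess n p k lam T b Γ H (0, t) = 0 := by
    rw [intervalIntegral.integral_congr (g := fun _ => (0 : ℝ)), intervalIntegral.integral_zero]
    intro t ht
    rw [uIcc_of_le zero_le_one] at ht
    simp only [lengthExcess, hH0 t ht, hV0 t ht, densitySq_ray, calibrationForm]
    have h3 : (k : ℝ) + 3 ≠ 0 := by positivity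
    have hS : 1 + T ^ 2 ≠ 0 := by positivity
    rw [show 1 + T * T = 1 + T ^ 2 by ring, hn]
    generalize √((1 + lam ^ 2 * T ^ 2) ^ p * (1 + T ^ 2)) = R
    generalize 1 + T ^ 2 = S at *
    field_simp
    ring
  have hvol : 0 ≤ sphereVolume n := measureReal_nonneg
  filter_upwards [hc, hpos] with s hs1 hs2
  rw [hs1, hc.self_of_nhds, hzero]
  refine mul_le_mul_of_nonneg_left (add_le_add ?_ le_rfl) hvol
  exact intervalIntegral.integral_nonneg zero_le_one hs2

end Segment

/-! ### Test functions on the logarithmic scale and failure of Hardy's inequality. -/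

theorem exists_bump_left : ∃ φ : ℝ → ℝ, ContDiff ℝ ∞ φ ∧ (∀ x ≤ -3, φ x = 0) ∧ φ 0 = 0 ∧
    φ (-2) = 1 := by
  let f : ContDiffBump (-2 : ℝ) := ⟨1 / 2, 1, by norm_num, by norm_num⟩
  refine ⟨f, f.contDiff, fun x hx => f.zero_of_le_dist ?_, f.zero_of_le_dist ?_, ?_⟩
  · change 1 ≤ dist x (-2)
    rw [Real.dist_eq, abs_of_nonpos (by linarith)]
    linarith
  · change 1 ≤ dist (0 : ℝ) (-2)
    rw [Real.dist_eq]; norm_num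
  · exact f.one_of_mem_closedBall (by simp [f.rIn_pos.le])

/-- A smooth function whose support is bounded away from `t = 0`, built on the logarithmic scale. -/
def logTest (a ε : ℝ) (φ : ℝ → ℝ) (t : ℝ) : ℝ :=
  Real.exp (-(a + 1) * Real.log t) * φ (ε * Real.log t)

theorem contDiff_logTest {a ε : ℝ} (hε : 0 < ε) {φ : ℝ → ℝ} (hφ : ContDiff ℝ ∞ φ)
    (h3 : ∀ x ≤ -3, φ x = 0) (h0 : φ 0 = 0) : ContDiff ℝ ∞ (logTest a ε φ) := by
  rw [contDiff_iff_contDiffAt]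
  intro t
  by_cases ht : t = 0
  · subst ht
    have h1 : Tendsto (fun t => ε * Real.log t) (𝓝[≠] 0) atBot :=
      Real.tendsto_log_nhdsNE_zero.const_mul_atBot hε
    have h2 : ∀ᶠ t in 𝓝[≠] (0 : ℝ), logTest a ε φ t = 0 := by
      filter_upwards [h1.eventually_le_atBot (-3)] with t ht
      simp [logTest, h3 _ ht]
    have h4 : ∀ᶠ t in 𝓝 (0 : ℝ), logTest a ε φ t = 0 := by
      rw [eventually_nhdsWithin_iff] at h2
      filter_upwards [h2] with t ht
      by_cases h : t = 0
      -- Since `Real.log 0 = 0`, the value at `t = 0` is `φ 0`; the hypothesis `φ 0 = 0` is needed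
      -- here as well as at `t = 1`.
      · simp [logTest, h, h0]
      · exact ht h
    exact (contDiffAt_const (c := (0 : ℝ))).congr_of_eventuallyEq h4
  · have hl : ContDiffAt ℝ ∞ Real.log t := Real.contDiffAt_log.2 ht
    exact (contDiffAt_const.mul hl).exp.mul (hφ.contDiffAt.comp t (contDiffAt_const.mul hl))

theorem hasDerivAt_logTest {a ε : ℝ} {φ : ℝ → ℝ} (hφ : ContDiff ℝ ∞ φ) {t : ℝ} (ht : t ≠ 0) :
    HasDerivAt (logTest a ε φ) (Real.exp (-(a + 1) * Real.log t) *
      (ε * deriv φ (ε * Real.log t) - (a + 1) * φ (ε * Real.log t)) / t) t := by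
  have hl := Real.hasDerivAt_log ht
  have hd : HasDerivAt φ (deriv φ (ε * Real.log t)) (ε * Real.log t) :=
    (hφ.differentiable (by simp) _).hasDerivAt
  have h2 : HasDerivAt (fun t => φ (ε * Real.log t)) _ t :=
    hd.comp t (hl.const_mul ε)
  refine ((hl.const_mul (-(a + 1))).exp.fun_mul h2).congr_deriv ?_
  field_simp
  ring

/-- The quadratic form `∫ t ^ (k + 2) (ψ' ^ 2 + 2 B ψ' ψ / t + C (ψ / t) ^ 2)` takes negative values
below the threshold of Hardy's inequality. -/
theorem exists_negative_test (k : ℕ) (B C : ℝ)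
    (h : ((k + 1 : ℝ) / 2) ^ 2 - (k + 1) * B + C < 0) :
    ∃ ζ : ℝ → ℝ, ContDiff ℝ ∞ ζ ∧ ζ 1 = 0 ∧
      ∫ t in (0 : ℝ)..1, t ^ (k + 2) * ((ζ t + t * deriv ζ t) ^ 2 +
        2 * B * ζ t * (ζ t + t * deriv ζ t) + C * ζ t ^ 2) < 0 := by
  obtain ⟨φ, hφ, h3, h0, h1⟩ := exists_bump_left
  -- The critical Hardy exponent: `ψ = t ζ = t ^ (-a) φ (ε log t)`, and `t ^ (k + 2)` times the
  -- square of `t ^ (-(a + 1))` is exactly `1 / t`, the density of `d log t`.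
  set a : ℝ := (k + 1) / 2 with ha
  set δ : ℝ := -(a ^ 2 - (k + 1) * B + C) with hδ
  have hδ0 : 0 < δ := by rw [hδ]; linarith
  have hφc := hφ.continuous
  have hφ'c : Continuous (deriv φ) := hφ.continuous_deriv (by simp)
  let J : ℝ → ℝ := fun x => ∫ u in (-4 : ℝ)..x, φ u ^ 2
  let J' : ℝ → ℝ := fun x => ∫ u in (-4 : ℝ)..x, deriv φ u ^ 2
  have hJ : ∀ x, HasDerivAt J (φ x ^ 2) x := fun x =>
    (hφc.pow 2).integral_hasStrictDerivAt _ _ |>.hasDerivAt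
  have hJ' : ∀ x, HasDerivAt J' (deriv φ x ^ 2) x := fun x =>
    (hφ'c.pow 2).integral_hasStrictDerivAt _ _ |>.hasDerivAt
  have hJ0 : 0 < J 0 := intervalIntegral.integral_pos (by norm_num) (hφc.pow 2).continuousOn
    (fun x _ => sq_nonneg _) ⟨-2, by constructor <;> norm_num, by rw [h1]; norm_num⟩
  have hJ'0 : 0 ≤ J' 0 := intervalIntegral.integral_nonneg (by norm_num) fun x _ => sq_nonneg _
  -- Chosen so that `ε ^ 2 J' 0 - δ J 0 = -ε ^ 2`: the gain `δ` then outweighs the cost of the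
  -- cutoff.
  set ε : ℝ := √(δ * J 0 / (J' 0 + 1)) with hε
  have hε0 : 0 < ε := Real.sqrt_pos.2 (by positivity)
  have hεsq : ε ^ 2 * (J' 0 + 1) = δ * J 0 := by
    rw [hε, Real.sq_sqrt (by positivity)]
    field_simp
  set ζ := logTest a ε φ with hζ
  have hζs : ContDiff ℝ ∞ ζ := contDiff_logTest hε0 hφ h3 h0
  refine ⟨ζ, hζs, by simp [hζ, logTest, h0], ?_⟩
  set I : ℝ → ℝ := fun t => t ^ (k + 2) * ((ζ t + t * deriv ζ t) ^ 2 +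
        2 * B * ζ t * (ζ t + t * deriv ζ t) + C * ζ t ^ 2) with hI
  have hIc : Continuous I := by
    have c1 := hζs.continuous
    have c2 : Continuous (deriv ζ) := hζs.continuous_deriv (by simp)
    fun_prop
  set t₀ := Real.exp (-4 / ε) with ht₀
  have ht₀p : 0 < t₀ := Real.exp_pos _
  have ht₀1 : t₀ ≤ 1 := Real.exp_le_one_iff.2 (by
    rw [div_nonpos_iff]; right; constructor <;> linarith)
  -- For `t ≤ exp (-4 / ε)` the argument of `φ` is at most `-4`, inside the region where `φ` and its
  -- derivative vanish.
  have hz : ∫ t in (0 : ℝ)..t₀, I t = 0 := by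
    rw [intervalIntegral.integral_congr (g := fun _ => (0 : ℝ)), intervalIntegral.integral_zero]
    intro t ht
    rw [uIcc_of_le ht₀p.le] at ht
    rcases ht.1.eq_or_lt with h | h
    · simp [hI, ← h]
    · have hlog : ε * Real.log t ≤ -4 := by
        have := Real.log_le_log h ht.2
        rw [ht₀, Real.log_exp, le_div_iff₀ hε0] at this
        linarith
      have e1 : φ (ε * Real.log t) = 0 := h3 _ (by linarith)
      have e2 : deriv φ (ε * Real.log t) = 0 := by
        have : φ =ᶠ[𝓝 (ε * Real.log t)] fun _ => 0 := by
          filter_upwards [Iio_mem_nhds (show ε * Real.log t < -3 by linarith)] with x hx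
          exact h3 x hx.le
        rw [this.deriv_eq]; simp
      have e3 : ζ t = 0 := by simp [hζ, logTest, e1]
      have e4 : deriv ζ t = 0 := by rw [(hasDerivAt_logTest hφ h.ne').deriv, e1, e2]; simp
      simp [hI, e3, e4]
  -- A primitive in `x = ε log t`: the integrand becomes `ε φ' ^ 2 - (δ / ε) φ ^ 2` plus the exact
  -- term `(B - a) (φ ^ 2)'`, which contributes nothing because `φ` vanishes at both ends.
  let G : ℝ → ℝ := fun x => ε * J' x - δ / ε * J x + (B - a) * φ x ^ 2
  have hG : ∀ t ∈ uIcc t₀ 1, HasDerivAt (fun t => G (ε * Real.log t)) (I t) t := by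
    intro t ht
    rw [uIcc_of_le ht₀1] at ht
    have htp : 0 < t := ht₀p.trans_le ht.1
    set x := ε * Real.log t with hx
    have hl : HasDerivAt (fun t => ε * Real.log t) (ε * t⁻¹) t :=
      (Real.hasDerivAt_log htp.ne').const_mul ε
    have hd : HasDerivAt φ (deriv φ x) x := (hφ.differentiable (by simp) _).hasDerivAt
    have hGx : HasDerivAt G _ x := (((hJ' x).const_mul ε).fun_sub ((hJ x).const_mul (δ / ε))).fun_add
      ((hd.fun_pow 2).const_mul (B - a))
    refine (hGx.comp t hl).congr_deriv ?_
    have e1 : ζ t = Real.exp (-(a + 1) * Real.log t) * φ x := rfl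
    have e2 := (hasDerivAt_logTest (a := a) (ε := ε) hφ htp.ne').deriv
    rw [← hζ, ← hx] at e2
    have e3 : ζ t + t * deriv ζ t = Real.exp (-(a + 1) * Real.log t) *
        (ε * deriv φ x - a * φ x) := by
      rw [e1, e2]; field_simp; ring
    have e4 : t ^ (k + 2) * Real.exp (-(a + 1) * Real.log t) ^ 2 = t⁻¹ := by
      have h5 : Real.exp (-(a + 1) * Real.log t) ^ 2 = (t ^ (k + 3))⁻¹ := by
        rw [← Real.exp_log (pow_pos htp (k + 3)), ← Real.exp_neg, ← Real.exp_nat_mul, Real.log_pow]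
        congr 1
        push_cast
        rw [ha]
        ring
      rw [h5]
      field_simp
      ring
    have e5 : I t = t⁻¹ * ((ε * deriv φ x - a * φ x) ^ 2 +
        2 * B * φ x * (ε * deriv φ x - a * φ x) + C * φ x ^ 2) := by
      simp only [hI]
      rw [e3, e1, ← e4]
      ring
    rw [e5]
    have e6 : δ = -(a ^ 2 - 2 * a * B + C) := by rw [hδ, ha]; ring
    rw [e6]
    field_simp
    push_cast
    ring
  have hmain : ∫ t in t₀..1, I t = G 0 := by
    rw [intervalIntegral.integral_eq_sub_of_hasDerivAt hG (hIc.intervalIntegrable _ _)]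
    have e1 : ε * Real.log t₀ = -4 := by rw [ht₀, Real.log_exp]; field_simp
    rw [e1]
    have e2 : G (-4) = 0 := by simp [G, J, J', h3 (-4) (by norm_num)]
    rw [e2]
    simp
  rw [← intervalIntegral.integral_add_adjacent_intervals (hIc.intervalIntegrable 0 t₀)
    (hIc.intervalIntegrable t₀ 1), hz, hmain, zero_add]
  have e : G 0 * ε = -ε ^ 2 := by
    simp only [G, h0]
    field_simp
    linear_combination hεsq
  by_contra! hcon
  have := mul_nonneg hcon hε0.le
  rw [e] at this
  nlinarith [pow_pos hε0 2]

/-! ### The second variation along vertical variations, and instability. -/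

/-- Second variation of the length integrand in the vertical direction. -/
theorem deriv_deriv_sqrt_density {n p : ℕ} {lam T α β : ℝ}
    (hcrit : p * lam ^ 2 * (1 + T ^ 2) = n * (1 + lam ^ 2 * T ^ 2)) :
    deriv (deriv fun s : ℝ =>
      √((1 + lam ^ 2 * (T + s * α) ^ 2) ^ p * (1 + (T + s * β) ^ 2))) 0 =
    √((1 + lam ^ 2 * T ^ 2) ^ p * (1 + T ^ 2)) / (1 + T ^ 2) ^ 2 *
      (β ^ 2 + 2 * (n * T ^ 2) * α * β +
        (n * (1 - lam ^ 2 * T ^ 2) * (1 + T ^ 2) / (1 + lam ^ 2 * T ^ 2) + n ^ 2 * T ^ 2) *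
          α ^ 2) := by
  let x : ℝ → ℝ := fun s => T + s * α
  let y : ℝ → ℝ := fun s => T + s * β
  let u : ℝ → ℝ := fun s => 1 + lam ^ 2 * x s ^ 2
  let v : ℝ → ℝ := fun s => 1 + y s ^ 2
  let f : ℝ → ℝ := fun s => √(u s ^ p * v s)
  -- The logarithmic derivative of `f`, so that `f'' = f (L ^ 2 + L')`.
  let L : ℝ → ℝ := fun s => p * lam ^ 2 * (α * x s / u s) + β * y s / v s
  have hx : ∀ s, HasDerivAt x α s := fun s => by
    exact (((hasDerivAt_id s).mul_const α).const_add T).congr_deriv (one_mul _)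
  have hy : ∀ s, HasDerivAt y β s := fun s => by
    exact (((hasDerivAt_id s).mul_const β).const_add T).congr_deriv (one_mul _)
  have hu : ∀ s, HasDerivAt u (lam ^ 2 * (2 * x s * α)) s := fun s => by
    refine ((((hx s).fun_pow 2).const_mul (lam ^ 2)).const_add 1).congr_deriv ?_
    norm_num
  have hv : ∀ s, HasDerivAt v (2 * y s * β) s := fun s => by
    refine (((hy s).fun_pow 2).const_add 1).congr_deriv ?_
    norm_num
  have hu0 : ∀ s, 0 < u s := fun s => by simp only [u]; positivity
  have hv0 : ∀ s, 0 < v s := fun s => by simp only [v]; positivity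
  have hf : ∀ s, HasDerivAt f (f s * L s) s := fun s => by
    have hpos : 0 < u s ^ p * v s := mul_pos (pow_pos (hu0 s) _) (hv0 s)
    refine ((((hu s).fun_pow p).fun_mul (hv s)).sqrt hpos.ne').congr_deriv ?_
    have hsq : f s ^ 2 = u s ^ p * v s := Real.sq_sqrt hpos.le
    have hf0 : f s ≠ 0 := (Real.sqrt_pos.2 hpos).ne'
    change _ / (2 * f s) = _
    rw [div_eq_iff (mul_ne_zero two_ne_zero hf0)]
    have e : f s * L s * (2 * f s) = 2 * (f s ^ 2 * L s) := by ring
    rw [e, hsq]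
    have h1 := (hu0 s).ne'
    have h2 := (hv0 s).ne'
    simp only [L]
    rcases p with _ | p
    · simp
      field_simp
    · simp only [Nat.add_sub_cancel]
      field_simp
      ring
  have hL : HasDerivAt L _ 0 :=
    ((((hx 0).const_mul α).fun_div (hu 0) (hu0 0).ne').const_mul (p * lam ^ 2)).fun_add
      (((hy 0).const_mul β).fun_div (hv 0) (hv0 0).ne')
  have hx0 : x 0 = T := by simp [x]
  have hy0 : y 0 = T := by simp [y]
  have hu00 : u 0 = 1 + lam ^ 2 * T ^ 2 := by simp [u, hx0]
  have hv00 : v 0 = 1 + T ^ 2 := by simp [v, hy0]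
  have hf00 : f 0 = √((1 + lam ^ 2 * T ^ 2) ^ p * (1 + T ^ 2)) := by simp only [f, hu00, hv00]
  have hd : deriv f = fun s => f s * L s := funext fun s => (hf s).deriv
  change deriv (deriv f) 0 = _
  rw [hd, ((hf 0).fun_mul hL).deriv]
  simp only [L, hx0, hy0, hu00, hv00, hf00]
  have hA : 0 < 1 + lam ^ 2 * T ^ 2 := by positivity
  have hS : 0 < 1 + T ^ 2 := by positivity
  have hpl : (p : ℝ) * lam ^ 2 = n * (1 + lam ^ 2 * T ^ 2) / (1 + T ^ 2) := by
    rw [eq_div_iff hS.ne']; exact hcrit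
  rw [hpl]
  field_simp
  ring

section Vertical

variable {ζ : ℝ → ℝ}

/-- The vertical variation `(t, t T + s t ζ(t))` of a segment of slope `T`. -/
def verticalVariation (T : ℝ) (ζ : ℝ → ℝ) (q : ℝ × ℝ) : ℝ × ℝ :=
  (q.2, q.2 * T + q.1 * (q.2 * ζ q.2))

theorem isProperVariation_vertical (θ : ℝ) (hζ : ContDiff ℝ ∞ ζ) (h1 : ζ 1 = 0) :
    IsProperVariation (segmentOQ θ) (verticalVariation (Real.tan θ) ζ) where
  contDiff := by unfold verticalVariation; fun_prop
  base t _ := by simp [verticalVariation, segmentOQ]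
  left s := by simp [verticalVariation, segmentOQ]
  right s := by simp [verticalVariation, segmentOQ, h1]
  mem_orbitSpace := Eventually.of_forall fun s t ht => ht.1

theorem velocity_vertical (T : ℝ) (hζ : ContDiff ℝ ∞ ζ) (s t : ℝ) :
    velocity (verticalVariation T ζ) (s, t) = (1, T + s * (ζ t + t * deriv ζ t)) := by
  have hc : ContDiff ℝ ∞ (verticalVariation T ζ) := by unfold verticalVariation; fun_prop
  refine (hasDerivAt_velocity hc s t).unique ?_
  have hd : HasDerivAt ζ (deriv ζ t) t := (hζ.differentiable (by simp) t).hasDerivAt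
  have h2 := ((hasDerivAt_id t).mul_const T).fun_add
    (((hasDerivAt_id t).fun_mul hd).const_mul s)
  refine ((hasDerivAt_id t).prodMk h2).congr_deriv ?_
  simp

theorem sphereVolume_pos (n : ℕ) : 0 < sphereVolume n := by
  rw [sphereVolume, Measure.toSphere_real_apply_univ]
  refine mul_pos ?_ ?_
  · rw [finrank_euclideanSpace_fin]; positivity
  · exact ENNReal.toReal_pos (Metric.measure_ball_pos _ _ one_pos).ne' measure_ball_lt_top.ne

/-- Moving only in the `ρ` direction keeps `r = t`, so after division by `t` the first coordinate is
`1` and the second variation is a positive multiple of the form in `exists_negative_test`, with `B =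
n T ^ 2`. -/
theorem isUnstableCurve_segmentOQ {θ : ℝ} {n p k : ℕ} {lam : ℝ} (hn : n = k + 2) (hpn : p ≤ n)
    (hcrit : p * lam ^ 2 * (1 + Real.tan θ ^ 2) = n * (1 + lam ^ 2 * Real.tan θ ^ 2))
    (h : ((k + 1 : ℝ) / 2) ^ 2 - (k + 1) * (n * Real.tan θ ^ 2) +
      (n * (1 - lam ^ 2 * Real.tan θ ^ 2) * (1 + Real.tan θ ^ 2) /
        (1 + lam ^ 2 * Real.tan θ ^ 2) + n ^ 2 * Real.tan θ ^ 2) < 0) :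
    IsUnstableCurve n p lam (segmentOQ θ) := by
  set T := Real.tan θ with hT
  obtain ⟨ζ, hζ, hζ1, hneg⟩ := exists_negative_test k _ _ h
  have hΓ := isProperVariation_vertical θ hζ hζ1
  refine ⟨_, hΓ, contDiffAt_variationLength lam hpn hΓ, ?_⟩
  rw [← hT] at hΓ ⊢
  let H : ℝ × ℝ → ℝ × ℝ := fun q => (1, T + q.1 * ζ q.2)
  have hH : ContDiff ℝ ∞ H := by fun_prop
  have hΓH : ∀ s t, verticalVariation T ζ (s, t) = t • H (s, t) := fun s t => by
    simp only [verticalVariation, H, Prod.smul_mk, smul_eq_mul]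
    ext <;> simp; ring
  rw [show variationLength n p lam (verticalVariation T ζ) = _ from
    funext fun s => variationLength_eq (lam := lam) hpn hΓ.contDiff hΓH s]
  simp only [deriv_const_mul_field']
  refine mul_neg_of_pos_of_neg (sphereVolume_pos n) ?_
  rw [deriv_deriv_integral_slice (K := fun q => q.2 ^ n *
    √(densitySq n p lam (H q) (velocity (verticalVariation T ζ) q)))]
  · have e : ∀ t, deriv (deriv fun s => t ^ n *
        √(densitySq n p lam (H (s, t)) (velocity (verticalVariation T ζ) (s, t)))) 0 =
        √((1 + lam ^ 2 * T ^ 2) ^ p * (1 + T ^ 2)) / (1 + T ^ 2) ^ 2 *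
        (t ^ (k + 2) * ((ζ t + t * deriv ζ t) ^ 2 +
          2 * (n * T ^ 2) * ζ t * (ζ t + t * deriv ζ t) +
          (n * (1 - lam ^ 2 * T ^ 2) * (1 + T ^ 2) / (1 + lam ^ 2 * T ^ 2) + n ^ 2 * T ^ 2) *
          ζ t ^ 2)) := fun t => by
      have e1 : ∀ s, densitySq n p lam (H (s, t)) (velocity (verticalVariation T ζ) (s, t)) =
          (1 + lam ^ 2 * (T + s * ζ t) ^ 2) ^ p * (1 + (T + s * (ζ t + t * deriv ζ t)) ^ 2) :=
        fun s => by
          rw [velocity_vertical T hζ]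
          simp [densitySq, H]
      simp only [e1, deriv_const_mul_field']
      rw [deriv_deriv_sqrt_density hcrit, hn]
      ring
    simp only [e, intervalIntegral.integral_const_mul]
    exact mul_neg_of_pos_of_neg (by positivity) hneg
  · intro t _
    refine contDiffAt_infty.1 (contDiffAt_density hΓ.contDiff hH (T := T) ?_ ?_) 2
    · simp [H]
    · rw [velocity_vertical T hζ]; simp

end Vertical

/-! ### Geometry of the spherical graph: the mean curvature identity. -/

section ConstantNorm

variable {E W V : Type*} [NormedAddCommGroup E] [NormedSpace ℝ E] [NormedAddCommGroup W]
  [NormedSpace ℝ W] [NormedAddCommGroup V] [InnerProductSpace ℝ V]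

/-- Differentiating `‖L Ψ‖ ^ 2 = const` once and twice. -/
theorem inner_fderiv_of_norm_const {Ψ : E → W} {x : E} (hΨ : ContDiffAt ℝ 2 Ψ x) (L : W →L[ℝ] V)
    {c : ℝ} (hc : ∀ᶠ y in 𝓝 x, ‖L (Ψ y)‖ = c) (u : E) :
    inner ℝ (L (Ψ x)) (L (fderiv ℝ Ψ x u)) = 0 ∧
    inner ℝ (L (Ψ x)) (L (fderiv ℝ (fderiv ℝ Ψ) x u u)) = -‖L (fderiv ℝ Ψ x u)‖ ^ 2 := by
  have hev : ∀ᶠ y in 𝓝 x, inner ℝ (L (Ψ y)) (L (fderiv ℝ Ψ y u)) = 0 := by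
    filter_upwards [hc.eventually_nhds, hΨ.eventually (by simp)] with y hy hd
    have hP : HasFDerivAt (fun y => L (Ψ y)) (L.comp (fderiv ℝ Ψ y)) y :=
      L.hasFDerivAt.comp y (hd.differentiableAt (by simp)).hasFDerivAt
    have h1 := hP.inner ℝ hP
    have h2 : (fun y => inner ℝ (L (Ψ y)) (L (Ψ y))) =ᶠ[𝓝 y] fun _ => c ^ 2 := by
      filter_upwards [hy] with z hz
      rw [real_inner_self_eq_norm_sq, hz]
    have h3 := h1.unique ((hasFDerivAt_const (c ^ 2) y).congr_of_eventuallyEq h2)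
    have h4 := congrArg (fun f => f u) h3
    simp [fderivInnerCLM_apply] at h4
    rw [real_inner_comm (L (Ψ y))] at h4
    linarith
  refine ⟨hev.self_of_nhds, ?_⟩
  have hP : HasFDerivAt (fun y => L (Ψ y)) (L.comp (fderiv ℝ Ψ x)) x :=
    L.hasFDerivAt.comp x (hΨ.differentiableAt (by simp)).hasFDerivAt
  have hd : HasFDerivAt (fderiv ℝ Ψ) (fderiv ℝ (fderiv ℝ Ψ) x) x :=
    ((hΨ.fderiv_right (m := 1) (by norm_num)).differentiableAt (by simp)).hasFDerivAt
  have hQ : HasFDerivAt (fun y => L (fderiv ℝ Ψ y u))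
      (L.comp ((fderiv ℝ (fderiv ℝ Ψ) x).flip u)) x := by
    refine L.hasFDerivAt.comp x ?_
    have := hd.clm_apply (hasFDerivAt_const u x)
    simpa using this
  have h1 := (hP.inner ℝ hQ).unique ((hasFDerivAt_const (0 : ℝ) x).congr_of_eventuallyEq hev)
  have h2 := congrArg (fun f => f u) h1
  simp [fderivInnerCLM_apply] at h2
  linarith

end ConstantNorm

/-- An orthonormal basis of right singular vectors. -/
theorem exists_orthonormalBasis_singularValues {E V : Type*} [NormedAddCommGroup E]
    [InnerProductSpace ℝ E] [FiniteDimensional ℝ E] [NormedAddCommGroup V] [InnerProductSpace ℝ V]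
    [FiniteDimensional ℝ V] {n : ℕ} (hn : Module.finrank ℝ E = n) (D : E →ₗ[ℝ] V) :
    ∃ e : OrthonormalBasis (Fin n) ℝ E, ∀ i j, inner ℝ (D (e i)) (D (e j)) =
      if i = j then D.singularValues i ^ 2 else 0 := by
  refine ⟨D.isSymmetric_adjoint_comp_self.eigenvectorBasis hn, fun i j => ?_⟩
  set e := D.isSymmetric_adjoint_comp_self.eigenvectorBasis hn with he
  have h1 := D.isSymmetric_adjoint_comp_self.apply_eigenvectorBasis hn j
  rw [LinearMap.comp_apply] at h1
  rw [← LinearMap.adjoint_inner_right, h1, inner_smul_right,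
    orthonormal_iff_ite.1 e.orthonormal i j, D.sq_singularValues_fin hn i]
  split_ifs with h
  · subst h; simp
  · simp

theorem radialExt_of_ne_zero {d : ℕ} {V : Type*} [NormedAddCommGroup V] [InnerProductSpace ℝ V]
    (F : Sph d → V) {y : Amb d} (hy : y ≠ 0) :
    radialExt F y = F ⟨‖y‖⁻¹ • y, inv_norm_smul_mem_sphere hy⟩ := by
  simp [radialExt, hy]

theorem radialExt_coe {d : ℕ} {V : Type*} [NormedAddCommGroup V] [InnerProductSpace ℝ V]
    (F : Sph d → V) (x : Sph d) : radialExt F (x : Amb d) = F x := by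
  have h1 : ‖(x : Amb d)‖ = 1 := norm_eq_of_mem_sphere x
  have hx : (x : Amb d) ≠ 0 := ne_zero_of_mem_unit_sphere x
  rw [radialExt_of_ne_zero F hx]
  congr 1
  ext1
  simp [h1]

theorem inner_coe_TSph {d : ℕ} (x : Sph d) (v : TSph x) : inner ℝ (x : Amb d) (v : Amb d) = 0 :=
  Submodule.mem_orthogonal_singleton_iff_inner_right.1 v.2

/-- The radial retraction, restricted to a tangent line, has the direction of the line as
derivative. -/
theorem hasDerivAt_normalize {d : ℕ} (x : Sph d) (v : TSph x) :
    HasDerivAt (fun s : ℝ => ‖(x : Amb d) + s • (v : Amb d)‖⁻¹ • ((x : Amb d) + s • (v : Amb d)))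
      (v : Amb d) 0 := by
  have h1 : ‖(x : Amb d)‖ = 1 := norm_eq_of_mem_sphere x
  have hnorm : ∀ s : ℝ, ‖(x : Amb d) + s • (v : Amb d)‖ = √(1 + s ^ 2 * ‖(v : Amb d)‖ ^ 2) :=
    fun s => by
      rw [← Real.sqrt_sq (norm_nonneg ((x : Amb d) + s • (v : Amb d))), norm_add_sq_real,
        inner_smul_right, inner_coe_TSph, h1, norm_smul, mul_pow, Real.norm_eq_abs, sq_abs]
      simp
  simp only [hnorm]
  have h2 : HasDerivAt (fun s : ℝ => 1 + s ^ 2 * ‖(v : Amb d)‖ ^ 2) 0 0 := by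
    refine (((hasDerivAt_pow 2 (0 : ℝ)).mul_const _).const_add 1).congr_deriv ?_
    simp
  have h3 := (h2.sqrt (by simp)).inv (by simp)
  have h4 : HasDerivAt (fun s : ℝ => (x : Amb d) + s • (v : Amb d)) (v : Amb d) 0 := by
    refine (((hasDerivAt_id (0 : ℝ)).smul_const (v : Amb d)).const_add (x : Amb d)).congr_deriv ?_
    simp
  refine (h3.fun_smul h4).congr_deriv ?_
  simp

theorem hasDerivAt_radialExt {d : ℕ} {V : Type*} [NormedAddCommGroup V] [InnerProductSpace ℝ V]
    {F : Sph d → V} {x : Sph d} (hF : DifferentiableAt ℝ (radialExt F) (x : Amb d))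
    (v : TSph x) :
    HasDerivAt (fun s : ℝ => radialExt F ((x : Amb d) + s • (v : Amb d))) (sphereDeriv F x v) 0 := by
  have h4 : HasDerivAt (fun s : ℝ => (x : Amb d) + s • (v : Amb d)) (v : Amb d) 0 := by
    refine (((hasDerivAt_id (0 : ℝ)).smul_const (v : Amb d)).const_add (x : Amb d)).congr_deriv ?_
    simp
  have h5 : HasFDerivAt (radialExt F) (fderiv ℝ (radialExt F) (x : Amb d))
    ((x : Amb d) + (0 : ℝ) • (v : Amb d)) := by simpa using hF.hasFDerivAt
  exact h5.comp_hasDerivAt 0 h4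

section Graph

variable {n m : ℕ} {η : Sph n → Sph m} {θ : ℝ}

theorem radialExt_sphericalGraph (y : Amb n) :
    radialExt (sphericalGraph η θ) y = WithLp.toLp 2
      (Real.cos θ • radialExt (fun z => (z : Amb n)) y,
        Real.sin θ • radialExt (fun z => (η z : Amb m)) y) := by
  by_cases hy : y = 0
  · subst hy; simp [radialExt]; rfl
  · simp [radialExt_of_ne_zero _ hy, sphericalGraph]

theorem contDiffAt_graph (hη : IsLOM η θ) (x : Sph n) :
    ContDiffAt ℝ 2 (radialExt (sphericalGraph η θ)) (x : Amb n) :=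
  hη.minimal.contDiffOn.contDiffAt
    (isOpen_compl_singleton.mem_nhds (ne_zero_of_mem_unit_sphere x))

theorem IsLOM.cos_pos (hη : IsLOM η θ) : 0 < Real.cos θ :=
  Real.cos_pos_of_mem_Ioo ⟨by linarith [hη.angle_mem.1, Real.pi_pos], hη.angle_mem.2⟩

theorem IsLOM.sin_pos (hη : IsLOM η θ) : 0 < Real.sin θ :=
  Real.sin_pos_of_mem_Ioo ⟨hη.angle_mem.1, by linarith [hη.angle_mem.2, Real.pi_pos]⟩

/-- The regularity of `η` is read from the second component of the immersion, divided by `sin θ ≠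
0`. -/
theorem differentiableAt_radialExt_map (hη : IsLOM η θ) (x : Sph n) :
    DifferentiableAt ℝ (radialExt fun z => (η z : Amb m)) (x : Amb n) := by
  have h1 := ((contDiffAt_graph hη x).differentiableAt (by simp))
  have h3 : DifferentiableAt ℝ (fun y => WithLp.sndL 2 ℝ (Amb n) (Amb m)
      (radialExt (sphericalGraph η θ) y)) (x : Amb n) :=
    (WithLp.sndL 2 ℝ (Amb n) (Amb m)).differentiableAt.comp _ h1
  have h2 : DifferentiableAt ℝ (fun y => (Real.sin θ)⁻¹ •
      WithLp.sndL 2 ℝ (Amb n) (Amb m) (radialExt (sphericalGraph η θ) y)) (x : Amb n) :=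
    h3.const_smul (Real.sin θ)⁻¹
  convert h2 using 2 with y
  rw [radialExt_sphericalGraph]
  simp [smul_smul, inv_mul_cancel₀ hη.sin_pos.ne']

theorem sphereDeriv_graph_fst (hη : IsLOM η θ) (x : Sph n) (v : TSph x) :
    (sphereDeriv (sphericalGraph η θ) x v).fst = Real.cos θ • (v : Amb n) := by
  have h1 := hasDerivAt_radialExt ((contDiffAt_graph hη x).differentiableAt (by simp)) v
  have h2 := (WithLp.fstL 2 ℝ (Amb n) (Amb m)).hasFDerivAt.comp_hasDerivAt 0 h1
  refine h2.unique (((hasDerivAt_normalize x v).const_smul (Real.cos θ)).congr_of_eventuallyEq ?_)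
  have h4 : ContinuousAt (fun s : ℝ => (x : Amb n) + s • (v : Amb n)) 0 := by fun_prop
  filter_upwards [h4.eventually_ne (by simpa using ne_zero_of_mem_unit_sphere x)] with s hs
  simp [radialExt_sphericalGraph, radialExt_of_ne_zero _ hs]

theorem sphereDeriv_graph_snd (hη : IsLOM η θ) (x : Sph n) (v : TSph x) :
    (sphereDeriv (sphericalGraph η θ) x v).snd =
      Real.sin θ • sphereDeriv (fun z => (η z : Amb m)) x v := by
  have h1 := hasDerivAt_radialExt ((contDiffAt_graph hη x).differentiableAt (by simp)) v
  have h2 := (WithLp.sndL 2 ℝ (Amb n) (Amb m)).hasFDerivAt.comp_hasDerivAt 0 h1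
  have h3 := (hasDerivAt_radialExt (differentiableAt_radialExt_map hη x) v).const_smul (Real.sin θ)
  refine h2.unique (h3.congr_of_eventuallyEq (Eventually.of_forall fun s => ?_))
  simp [radialExt_sphericalGraph]

theorem finrank_TSph (x : Sph n) : Module.finrank ℝ (TSph x) = n :=
  Submodule.finrank_orthogonal_span_singleton (ne_zero_of_mem_unit_sphere x)

theorem norm_radialExt_coe {d e : ℕ} (f : Sph d → Sph e) {y : Amb d} (hy : y ≠ 0) :
    ‖radialExt (fun z => (f z : Amb e)) y‖ = 1 := by
  rw [radialExt_of_ne_zero _ hy]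
  exact norm_eq_of_mem_sphere _

/-- Vanishing of the mean curvature in the normal direction `(-sin θ · x, cos θ · η(x))`. -/
theorem sum_singVal_eq_zero (hη : IsLOM η θ) (x : Sph n) :
    ∑ i, (1 - singVal η x i ^ 2) /
      (Real.cos θ ^ 2 + Real.sin θ ^ 2 * singVal η x i ^ 2) = 0 := by
  set c := Real.cos θ with hc
  set s := Real.sin θ with hs
  have hc0 : 0 < c := hη.cos_pos
  have hs0 : 0 < s := hη.sin_pos
  set D := sphereDeriv (fun z => (η z : Amb m)) x with hD
  set F := sphericalGraph η θ with hF
  set Ψ := radialExt F with hΨdef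
  have hΨ : ContDiffAt ℝ 2 Ψ (x : Amb n) := contDiffAt_graph hη x
  obtain ⟨e, he⟩ := exists_orthonormalBasis_singularValues (finrank_TSph x) D
  have hlam : ∀ i : Fin n, D.singularValues i = singVal η x i := fun i => rfl
  set μ : Fin n → ℝ := fun i => c ^ 2 + s ^ 2 * singVal η x i ^ 2 with hμ
  have hμ0 : ∀ i, 0 < μ i := fun i => by simp only [hμ]; positivity
  have hfst : ∀ v : TSph x, (sphereDeriv F x v).fst = c • (v : Amb n) := sphereDeriv_graph_fst hη x
  have hsnd : ∀ v : TSph x, (sphereDeriv F x v).snd = s • D v := sphereDeriv_graph_snd hη x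
  have hev : ∀ᶠ y in 𝓝 (x : Amb n), y ≠ 0 := eventually_ne_nhds (ne_zero_of_mem_unit_sphere x)
  have hL1 := fun v : TSph x => inner_fderiv_of_norm_const hΨ (WithLp.fstL 2 ℝ (Amb n) (Amb m))
    (c := c) (by
      filter_upwards [hev] with y hy
      have := norm_radialExt_coe (fun z : Sph n => z) hy
      simp [hΨdef, hF, radialExt_sphericalGraph, norm_smul, this, abs_of_pos hc0, ← hc]) (v : Amb n)
  have hL2 := fun v : TSph x => inner_fderiv_of_norm_const hΨ (WithLp.sndL 2 ℝ (Amb n) (Amb m))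
    (c := s) (by
      filter_upwards [hev] with y hy
      have := norm_radialExt_coe η hy
      simp [hΨdef, hF, radialExt_sphericalGraph, norm_smul, this, abs_of_pos hs0, ← hs]) (v : Amb n)
  have hΨx : Ψ x = WithLp.toLp 2 (c • (x : Amb n), s • (η x : Amb m)) := by
    rw [hΨdef, radialExt_coe]; rfl
  let ν : Amb2 n m := WithLp.toLp 2 (-s • (x : Amb n), c • (η x : Amb m))
  have hxn : ‖(x : Amb n)‖ = 1 := norm_eq_of_mem_sphere x
  have hηn : ‖(η x : Amb m)‖ = 1 := norm_eq_of_mem_sphere (η x)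
  -- Pairing with `ν` becomes a combination of pairings with the two components of `Ψ`. These have
  -- constant norms `c` and `s`, so differentiating the norms gives their pairings with first and
  -- second derivatives, with no second derivative computed explicitly.
  have hinner : ∀ w : Amb2 n m, inner ℝ ν w =
      -(s / c) * inner ℝ (Ψ x).fst w.fst + (c / s) * inner ℝ (Ψ x).snd w.snd := fun w => by
    rw [WithLp.prod_inner_apply, hΨx]
    change inner ℝ (-s • (x : Amb n)) w.fst + inner ℝ (c • (η x : Amb m)) w.snd =
      -(s / c) * inner ℝ (c • (x : Amb n)) w.fst + (c / s) * inner ℝ (s • (η x : Amb m)) w.snd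
    simp only [real_inner_smul_left]
    field_simp
  have hν : ν ∈ normalSpace F x := by
    rw [normalSpace, Submodule.mem_orthogonal']
    intro w hw
    obtain ⟨a, ha, b, hb, rfl⟩ := Submodule.mem_sup.1 hw
    obtain ⟨r, rfl⟩ := Submodule.mem_span_singleton.1 ha
    obtain ⟨v, rfl⟩ := hb
    have e1 : inner ℝ ν (F x) = 0 := by
      have : F x = Ψ x := (radialExt_coe F x).symm
      rw [hinner, this, real_inner_self_eq_norm_sq, real_inner_self_eq_norm_sq, hΨx]
      simp [norm_smul, hxn, hηn, abs_of_pos hc0, abs_of_pos hs0]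
      field_simp
      ring
    have e2 : inner ℝ ν (sphereDeriv F x v) = 0 := by
      rw [hinner]
      have h1 : inner ℝ (Ψ x).fst (sphereDeriv F x v).fst = 0 := (hL1 v).1
      have h2 : inner ℝ (Ψ x).snd (sphereDeriv F x v).snd = 0 := (hL2 v).1
      rw [h1, h2]; simp
    rw [inner_add_right, inner_smul_right, e1, e2]; simp
  have hmin : IsMinimalImmersion F := hη.minimal
  -- The singular vectors are orthogonal for the induced metric too, with squared length `μ i`;
  -- rescaling makes them an orthonormal frame.
  have hmean := hmin.meanCurvature_eq_zero x (fun i => (√(μ i))⁻¹ • e i) (fun i j => by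
    have h1 : inner ℝ (sphereDeriv F x (e i)) (sphereDeriv F x (e j)) =
        if i = j then μ i else 0 := by
      rw [WithLp.prod_inner_apply]
      change inner ℝ (sphereDeriv F x (e i)).fst (sphereDeriv F x (e j)).fst +
        inner ℝ (sphereDeriv F x (e i)).snd (sphereDeriv F x (e j)).snd = _
      rw [hfst, hfst, hsnd, hsnd]
      simp only [real_inner_smul_left, real_inner_smul_right, he]
      rw [← Submodule.coe_inner, orthonormal_iff_ite.1 e.orthonormal i j]
      split_ifs
      · rw [hlam]; simp only [hμ]; ring
      · simp
    rw [map_smul, map_smul, real_inner_smul_left, real_inner_smul_right, h1]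
    split_ifs with h
    · subst h
      have h3 : √(μ i) ^ 2 = μ i := Real.sq_sqrt (hμ0 i).le
      have h4 : √(μ i) ≠ 0 := (Real.sqrt_pos.2 (hμ0 i)).ne'
      nth_rewrite 3 [← h3]
      field_simp
    · simp)
  have hsff : ∀ v : TSph x, inner ℝ ν (secondFundamentalForm F x v v) =
      s * c * (‖(v : Amb n)‖ ^ 2 - ‖D v‖ ^ 2) := fun v => by
    rw [secondFundamentalForm, ← Submodule.inner_starProjection_left_eq_right,
      Submodule.starProjection_eq_self_iff.2 hν, hinner]
    have h1 := (hL1 v).2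
    have h2 := (hL2 v).2
    have h3 : (WithLp.fstL 2 ℝ (Amb n) (Amb m)) (fderiv ℝ Ψ x (v : Amb n)) = c • (v : Amb n) :=
      hfst v
    have h4 : (WithLp.sndL 2 ℝ (Amb n) (Amb m)) (fderiv ℝ Ψ x (v : Amb n)) = s • D v := hsnd v
    rw [h3] at h1
    rw [h4] at h2
    simp only [WithLp.fstL_apply, WithLp.sndL_apply] at h1 h2
    rw [h1, h2, norm_smul, norm_smul, Real.norm_of_nonneg hc0.le, Real.norm_of_nonneg hs0.le]
    field_simp
    ring
  have h0 := congrArg (inner ℝ ν) hmean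
  rw [inner_sum, inner_zero_right] at h0
  simp only [hsff] at h0
  have hterm : ∀ i, s * c * (‖(((√(μ i))⁻¹ • e i : TSph x) : Amb n)‖ ^ 2 -
      ‖D ((√(μ i))⁻¹ • e i)‖ ^ 2) = s * c * ((1 - singVal η x i ^ 2) / μ i) := fun i => by
    have h3 : √(μ i) ^ 2 = μ i := Real.sq_sqrt (hμ0 i).le
    have h5 : ‖D (e i)‖ ^ 2 = singVal η x i ^ 2 := by
      rw [← real_inner_self_eq_norm_sq, he, if_pos rfl, hlam]
    rw [map_smul, Submodule.coe_smul, norm_smul, norm_smul, mul_pow, mul_pow, h5,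
      Submodule.norm_coe, e.orthonormal.1 i, Real.norm_eq_abs, sq_abs, inv_pow, h3]
    ring
  simp only [hterm, ← Finset.mul_sum] at h0
  exact (mul_eq_zero.1 h0).resolve_left (by positivity)

end Graph

/-! ### Harmonic polynomials: the sum of squared singular values. -/

theorem hasDerivAt_eval_mvPolynomial {σ : Type*} [Fintype σ] (P : MvPolynomial σ ℝ)
    {c : ℝ → σ → ℝ} {c' : σ → ℝ} {s : ℝ} (hc : ∀ i, HasDerivAt (fun s => c s i) (c' i) s) :
    HasDerivAt (fun s => MvPolynomial.eval (c s) P)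
      (∑ i, MvPolynomial.eval (c s) (MvPolynomial.pderiv i P) * c' i) s := by
  classical
  induction P using MvPolynomial.induction_on with
  | C a => simpa using hasDerivAt_const s a
  | add P Q hP hQ =>
    simp only [map_add, add_mul, Finset.sum_add_distrib]
    exact hP.fun_add hQ
  | mul_X P j hP =>
    simp only [map_mul, MvPolynomial.eval_X]
    refine (hP.fun_mul (hc j)).congr_deriv ?_
    simp only [Derivation.leibniz, smul_eq_mul, MvPolynomial.pderiv_X, map_add, map_mul,
      MvPolynomial.eval_X, add_mul, Finset.sum_add_distrib]
    rw [add_comm]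
    congr 1
    · rw [Finset.sum_eq_single j]
      · simp
      · intro i _ hij; simp [hij.symm]
      · simp
    · rw [Finset.sum_mul]
      exact Finset.sum_congr rfl fun i _ => by ring

section Laplacian

variable {σ : Type*} [Fintype σ]

/-- The Laplacian of a polynomial. -/
def polyLaplacian (P : MvPolynomial σ ℝ) : MvPolynomial σ ℝ :=
  ∑ i, MvPolynomial.pderiv i (MvPolynomial.pderiv i P)

theorem polyLaplacian_sq (P : MvPolynomial σ ℝ) :
    polyLaplacian (P ^ 2) = 2 * P * polyLaplacian P + 2 * ∑ i, MvPolynomial.pderiv i P ^ 2 := by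
  simp only [polyLaplacian, Finset.mul_sum, ← Finset.sum_add_distrib]
  refine Finset.sum_congr rfl fun i _ => ?_
  simp only [pow_two, Derivation.leibniz, smul_eq_mul, map_add]
  ring

theorem polyLaplacian_sum {ι : Type*} (s : Finset ι) (P : ι → MvPolynomial σ ℝ) :
    polyLaplacian (∑ j ∈ s, P j) = ∑ j ∈ s, polyLaplacian (P j) := by
  simp only [polyLaplacian, map_sum]
  exact Finset.sum_comm

theorem pderiv_sum_X_sq [DecidableEq σ] (i : σ) :
    MvPolynomial.pderiv i (∑ j, MvPolynomial.X j ^ 2 : MvPolynomial σ ℝ) =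
      2 * MvPolynomial.X i := by
  rw [map_sum, Finset.sum_eq_single i]
  · simp [pow_two, two_mul]
  · intro j _ hij
    simp [pow_two, MvPolynomial.pderiv_X, hij]
  · simp

theorem eval_polyLaplacian_sum_X_sq_pow (k : ℕ) {x : σ → ℝ} (hx : ∑ i, x i ^ 2 = 1) :
    MvPolynomial.eval x (polyLaplacian ((∑ j, MvPolynomial.X j ^ 2) ^ k)) =
      2 * k * (2 * k + Fintype.card σ - 2) := by
  classical
  have hN : MvPolynomial.eval x (∑ j, MvPolynomial.X j ^ 2) = 1 := by simpa using hx
  have h1 : ∀ i, MvPolynomial.eval x (MvPolynomial.pderiv i (MvPolynomial.pderiv i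
      ((∑ j, MvPolynomial.X j ^ 2 : MvPolynomial σ ℝ) ^ k))) =
      4 * k * (k - 1) * x i ^ 2 + 2 * k := fun i => by
    rcases k with _ | k
    · simp
    · rw [Derivation.leibniz_pow, pderiv_sum_X_sq, Nat.add_sub_cancel]
      simp only [smul_eq_mul, Derivation.leibniz, Derivation.leibniz_pow,
        pderiv_sum_X_sq, MvPolynomial.pderiv_X_self, nsmul_eq_mul, map_mul, map_add, map_pow, hN,
        MvPolynomial.eval_X, map_natCast]
      have h2 : MvPolynomial.pderiv i (2 : MvPolynomial σ ℝ) = 0 := by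
        simpa using (MvPolynomial.pderiv i : Derivation ℝ (MvPolynomial σ ℝ) _).map_natCast 2
      have h3 : MvPolynomial.eval x (2 : MvPolynomial σ ℝ) = 2 := by
        simp
      simp [h2, h3]
      ring
  simp only [polyLaplacian, map_sum, h1, Finset.sum_add_distrib, ← Finset.mul_sum, hx]
  simp
  ring

end Laplacian

theorem eval_smul_of_isHomogeneous {σ : Type*} [Fintype σ] {P : MvPolynomial σ ℝ} {k : ℕ}
    (hP : P.IsHomogeneous k) (a : ℝ) (y : σ → ℝ) :
    MvPolynomial.eval (a • y) P = a ^ k * MvPolynomial.eval y P := by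
  rw [MvPolynomial.eval_eq', MvPolynomial.eval_eq', Finset.mul_sum]
  refine Finset.sum_congr rfl fun d hd => ?_
  have h1 : ∑ i, d i = k := by
    rw [← hP (MvPolynomial.mem_support_iff.1 hd), Finsupp.weight_apply,
      Finsupp.sum_fintype _ _ (by simp)]
    simp
  simp only [Pi.smul_apply, smul_eq_mul, mul_pow, Finset.prod_mul_distrib,
    Finset.prod_pow_eq_pow_sum, h1]
  ring

section Harmonic

variable {n m : ℕ} {η : Sph n → Sph m} {θ : ℝ}

theorem sum_sq_coe_sphere {d : ℕ} (x : Sph d) : ∑ i, (x : Amb d) i ^ 2 = 1 := by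
  rw [← EuclideanSpace.real_norm_sq_eq, norm_eq_of_mem_sphere x]
  norm_num

/-- The sum of squares of harmonic coordinate functions is a power of `|y| ^ 2`. -/
theorem sum_sq_eq_pow {k : ℕ} {P : Fin (m + 1) → MvPolynomial (Fin (n + 1)) ℝ}
    (hP : ∀ j, (P j).IsHomogeneous k)
    (hη : ∀ j, ∀ x : Sph n, (η x : Amb m) j = MvPolynomial.eval (fun i => (x : Amb n) i) (P j)) :
    ∑ j, P j ^ 2 = (∑ i, MvPolynomial.X i ^ 2) ^ k := by
  have hsph : ∀ y : Fin (n + 1) → ℝ, y ≠ 0 → MvPolynomial.eval y (∑ j, P j ^ 2) =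
      MvPolynomial.eval y ((∑ i, MvPolynomial.X i ^ 2) ^ k) := fun y hy => by
    let z : Amb n := WithLp.toLp 2 y
    have hz : z ≠ 0 := fun h => hy (by simpa [z] using h)
    have hz0 : ‖z‖ ≠ 0 := norm_ne_zero_iff.2 hz
    have h1 := sum_sq_coe_sphere (η ⟨‖z‖⁻¹ • z, inv_norm_smul_mem_sphere hz⟩)
    have h2 : ∀ j, MvPolynomial.eval y (P j) = ‖z‖ ^ k *
        (η ⟨‖z‖⁻¹ • z, inv_norm_smul_mem_sphere hz⟩ : Amb m) j := fun j => by
      rw [hη]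
      have h3 : y = ‖z‖ • fun i => (‖z‖⁻¹ • z) i := by
        ext i
        simp [z, mul_inv_cancel_left₀ hz0]
      conv_lhs => rw [h3]
      exact eval_smul_of_isHomogeneous (hP j) _ _
    have h4 : ‖z‖ ^ 2 = ∑ i, y i ^ 2 := EuclideanSpace.real_norm_sq_eq z
    simp only [map_sum, map_pow, MvPolynomial.eval_X, h2, mul_pow, ← Finset.mul_sum, h1]
    rw [← h4]
    ring
  -- The identity is known only off the origin; points with all coordinates nonzero form a product
  -- of infinite sets, enough to identify polynomials.
  refine MvPolynomial.funext_set (fun _ => {0}ᶜ) (fun _ => (finite_singleton 0).infinite_compl)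
    fun y hy => hsph y fun h => ?_
  exact hy 0 (mem_univ _) (by simp [h])

/-- For a map of harmonic degree `k`, the sum of the squares of the singular values is
`k (k + n - 1)`. -/
theorem sum_sq_singVal {k : ℕ} (hLOM : IsLOM η θ) (hk : HasHarmonicDegree η k) (x : Sph n) :
    ∑ i, singVal η x i ^ 2 = k * (k + n - 1) := by
  choose P hhom hharm heval using hk
  set X : Fin (n + 1) → ℝ := fun i => (x : Amb n) i with hX
  have hX1 : ∑ i, X i ^ 2 = 1 := sum_sq_coe_sphere x
  have hη1 : ∑ j, MvPolynomial.eval X (P j) ^ 2 = 1 := by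
    simp only [hX, ← heval]
    exact sum_sq_coe_sphere (η x)
  -- Apply the Laplacian to `∑ P_j ^ 2 = |y| ^ (2 k)`: harmonicity leaves twice the sum of the
  -- squared gradients on the left.
  have hgrad : ∑ j, ∑ i, MvPolynomial.eval X (MvPolynomial.pderiv i (P j)) ^ 2 =
      k * (2 * k + n - 1) := by
    have h1 := congrArg (fun Q => MvPolynomial.eval X (polyLaplacian Q))
      (sum_sq_eq_pow hhom heval)
    have h0 : ∀ j, polyLaplacian (P j) = 0 := hharm
    simp only [polyLaplacian_sum, polyLaplacian_sq, h0,
      eval_polyLaplacian_sum_X_sq_pow k hX1] at h1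
    simp [← Finset.mul_sum] at h1
    linarith
  set D := sphereDeriv (fun z => (η z : Amb m)) x with hD
  obtain ⟨e, he⟩ := exists_orthonormalBasis_singularValues (finrank_TSph x) D
  let g : Fin (m + 1) → Amb n := fun j =>
    WithLp.toLp 2 fun i => MvPolynomial.eval X (MvPolynomial.pderiv i (P j))
  have hDg : ∀ (v : TSph x) j, D v j = inner ℝ (g j) (v : Amb n) := fun v j => by
    have h1 := hasDerivAt_radialExt (differentiableAt_radialExt_map hLOM x) v
    have h2 : HasDerivAt (fun s : ℝ => radialExt (fun z => (η z : Amb m))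
        ((x : Amb n) + s • (v : Amb n)) j) (D v j) 0 :=
      (EuclideanSpace.proj (𝕜 := ℝ) j).hasFDerivAt.comp_hasDerivAt 0 h1
    have h3 := hasDerivAt_normalize x v
    have h4 := hasDerivAt_eval_mvPolynomial (P j) (s := 0)
      (c := fun s i => (‖(x : Amb n) + s • (v : Amb n)‖⁻¹ • ((x : Amb n) + s • (v : Amb n))) i)
      (c' := fun i => (v : Amb n) i)
      (fun i => (EuclideanSpace.proj (𝕜 := ℝ) i).hasFDerivAt.comp_hasDerivAt 0 h3)
    have hx1 : ‖(x : Amb n)‖ = 1 := norm_eq_of_mem_sphere x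
    have h5 : (fun s : ℝ => radialExt (fun z => (η z : Amb m))
        ((x : Amb n) + s • (v : Amb n)) j) =ᶠ[𝓝 0] fun s => MvPolynomial.eval
        (fun i => (‖(x : Amb n) + s • (v : Amb n)‖⁻¹ • ((x : Amb n) + s • (v : Amb n))) i)
        (P j) := by
      have h6 : ContinuousAt (fun s : ℝ => (x : Amb n) + s • (v : Amb n)) 0 := by fun_prop
      filter_upwards [h6.eventually_ne (by simpa using ne_zero_of_mem_unit_sphere x)] with s hs
      rw [radialExt_of_ne_zero _ hs, heval]
    rw [h2.unique (h4.congr_of_eventuallyEq h5)]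
    simp [g, PiLp.inner_apply, hx1, hX, mul_comm]
  have hgx : ∀ j, inner ℝ (x : Amb n) (g j) = k * MvPolynomial.eval X (P j) := fun j => by
    have h1 := congrArg (MvPolynomial.eval X) (hhom j).sum_X_mul_pderiv
    simp only [map_sum, map_mul, MvPolynomial.eval_X, nsmul_eq_mul, map_natCast] at h1
    rw [← h1]
    simp [g, PiLp.inner_apply, hX, mul_comm]
  -- Only the tangential part of the gradient is seen by `D`; its radial part is `k P_j` by Euler's
  -- identity.
  have hg : ∀ j, ∑ i, (D (e i) j) ^ 2 = ∑ i, MvPolynomial.eval X (MvPolynomial.pderiv i (P j)) ^ 2 -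
      k ^ 2 * MvPolynomial.eval X (P j) ^ 2 := fun j => by
    have h1 : ‖g j‖ ^ 2 = ∑ i, MvPolynomial.eval X (MvPolynomial.pderiv i (P j)) ^ 2 :=
      EuclideanSpace.real_norm_sq_eq _
    have hx1 : ‖(x : Amb n)‖ = 1 := norm_eq_of_mem_sphere x
    let w : TSph x := ⟨g j - inner ℝ (x : Amb n) (g j) • (x : Amb n), by
      rw [Submodule.mem_orthogonal_singleton_iff_inner_right, inner_sub_right,
        real_inner_smul_right, real_inner_self_eq_norm_sq, hx1]
      ring⟩
    have h2 : ∀ i, D (e i) j = inner ℝ w (e i) := fun i => by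
      rw [hDg, Submodule.coe_inner, inner_sub_left, real_inner_smul_left, inner_coe_TSph]
      ring
    have h3 : ‖w‖ ^ 2 = ‖g j‖ ^ 2 - inner ℝ (x : Amb n) (g j) ^ 2 := by
      rw [Submodule.norm_coe w |>.symm]
      change ‖g j - inner ℝ (x : Amb n) (g j) • (x : Amb n)‖ ^ 2 = _
      rw [norm_sub_sq_real, real_inner_smul_right, real_inner_comm, norm_smul, hx1, mul_one,
        Real.norm_eq_abs, sq_abs]
      ring
    simp only [h2]
    rw [e.sum_sq_inner_left, h3, h1, hgx]
    ring
  have hnorm : ∀ i, singVal η x i ^ 2 = ∑ j, (D (e i) j) ^ 2 := fun i => by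
    have h1 := he i i
    rw [if_pos rfl, real_inner_self_eq_norm_sq, EuclideanSpace.real_norm_sq_eq] at h1
    exact h1.symm
  simp only [hnorm]
  rw [Finset.sum_comm]
  simp only [hg, Finset.sum_sub_distrib, ← Finset.mul_sum, hgrad, hη1]
  ring

end Harmonic

/-! ### Two singular values: the critical angle and the stability threshold. -/

section TwoValues

variable {n p : ℕ} {f : Fin n → ℝ} {lam : ℝ}

theorem ncard_le (hp : Set.ncard {i : Fin n | f i = lam} = p) : p ≤ n := by
  rw [← hp]
  simpa using Set.ncard_le_card {i : Fin n | f i = lam}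

theorem sum_comp_of_range_eq (hrange : range f = {0, lam})
    (hp : Set.ncard {i : Fin n | f i = lam} = p) (g : ℝ → ℝ) :
    ∑ i, g (f i) = p * g lam + ((n - p : ℕ) : ℝ) * g 0 := by
  classical
  have h1 : (Finset.univ.filter fun i => f i = lam).card = p := by
    rw [← hp, Set.ncard_eq_toFinset_card']
    simp
  have h2 : (Finset.univ.filter fun i => ¬ f i = lam).card = n - p := by
    have := Finset.card_filter_add_card_filter_not (s := (Finset.univ : Finset (Fin n)))
      (fun i => f i = lam)
    rw [Finset.card_univ, Fintype.card_fin] at this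
    omega
  rw [← Finset.sum_filter_add_sum_filter_not Finset.univ (fun i => f i = lam)]
  congr 1
  · rw [Finset.sum_congr rfl (g := fun _ => g lam), Finset.sum_const, h1, nsmul_eq_mul]
    intro i hi
    rw [(Finset.mem_filter.1 hi).2]
  · rw [Finset.sum_congr rfl (g := fun _ => g 0), Finset.sum_const, h2, nsmul_eq_mul]
    intro i hi
    have h3 : f i ∈ ({0, lam} : Set ℝ) := hrange ▸ mem_range_self i
    rw [h3.resolve_right (Finset.mem_filter.1 hi).2]

theorem multiplicity_pos (hrange : range f = {0, lam})
    (hp : Set.ncard {i : Fin n | f i = lam} = p) : 0 < p := by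
  obtain ⟨i, hi⟩ : lam ∈ range f := by rw [hrange]; simp
  rw [← hp, Set.ncard_pos]
  exact ⟨i, hi⟩

theorem two_le_of_range_eq (hlam : 0 < lam) (hrange : range f = {0, lam}) : 2 ≤ n := by
  obtain ⟨i, hi⟩ : lam ∈ range f := by rw [hrange]; simp
  obtain ⟨j, hj⟩ : (0 : ℝ) ∈ range f := by rw [hrange]; simp
  have hij : i ≠ j := fun h => by rw [h, hj] at hi; exact hlam.ne hi
  by_contra! h
  exact hij (Fin.ext (by omega))

end TwoValues

/-- The angle of a map with singular values `0` and `lam` of multiplicities `n - p` and `p`. -/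
theorem IsLOM.critical_angle {n m p : ℕ} {η : Sph n → Sph m} {θ lam : ℝ} (hη : IsLOM η θ)
    {x : Sph n} (hrange : range (singVal η x) = {0, lam})
    (hp : Set.ncard {i : Fin n | singVal η x i = lam} = p) :
    p * (lam ^ 2 - 1) = ((n - p : ℕ) : ℝ) * (1 + lam ^ 2 * Real.tan θ ^ 2) := by
  have h := sum_singVal_eq_zero hη x
  rw [sum_comp_of_range_eq hrange hp fun l => (1 - l ^ 2) /
      (Real.cos θ ^ 2 + Real.sin θ ^ 2 * l ^ 2)] at h
  have hc := hη.cos_pos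
  have hd : 0 < Real.cos θ ^ 2 + Real.sin θ ^ 2 * lam ^ 2 := by positivity
  rw [Real.tan_eq_sin_div_cos]
  simp only [ne_eq, OfNat.ofNat_ne_zero, not_false_eq_true, zero_pow, mul_zero, add_zero,
    sub_zero] at h
  field_simp at h ⊢
  linarith

/-- The critical equation eliminates the angle and leaves only `n = p + M` and `p λ ^ 2`. With the
Hardy term `(n - 1) ^ 2 / 2` added, the right side is twice the threshold of the unstable case. -/
theorem second_variation_stable_eq {p M τ L : ℝ} (hp : 0 < p) (hτ : 0 ≤ τ) (hL : 0 < L)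
    (h : p * (L - 1) = M * (1 + L * τ)) :
    p * ((2 * τ + 2 * L) / (1 + L * τ) - 4 * τ * (L - 1) ^ 2 / (1 + L * τ) ^ 2) - 2 * M * τ =
      -2 * (p + M) + 4 * (p + M) ^ 2 / (p * L) := by
  have hA : 0 < 1 + L * τ := by positivity
  obtain rfl : M = p * (L - 1) / (1 + L * τ) := by rw [eq_div_iff hA.ne', h]
  field_simp
  ring

theorem second_variation_unstable_eq {p n τ L : ℝ} (hp : 0 < p) (hτ : 0 ≤ τ) (hL : 0 < L)
    (h : p * L * (1 + τ) = n * (1 + L * τ)) :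
    n * (1 - L * τ) * (1 + τ) / (1 + L * τ) + n * τ = -n + 2 * n ^ 2 / (p * L) := by
  have hA : 0 < 1 + L * τ := by positivity
  obtain rfl : n = p * L * (1 + τ) / (1 + L * τ) := by rw [eq_div_iff hA.ne', h]
  field_simp
  ring

end LawsonOsserman

end

/-! ### The theorem: evaluation of the threshold. -/

open LawsonOsserman in
theorem theorem5 {n m : ℕ} (η : LawsonOsserman.Sph n → LawsonOsserman.Sph m) (θ : ℝ)
    (hη : LawsonOsserman.IsLOMSE η θ)
    (x : LawsonOsserman.Sph n) (p : ℕ) (lam : ℝ) (hlam : 0 < lam)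
    (hrange : Set.range (LawsonOsserman.singVal η x) = {0, lam})
    (hp : Set.ncard {i : Fin n | LawsonOsserman.singVal η x i = lam} = p) :
    LawsonOsserman.IsOrbitGeodesic n p lam (LawsonOsserman.segmentOQ θ) ∧
      (LawsonOsserman.IsTypeI η p →
        LawsonOsserman.IsStableCurve n p lam (LawsonOsserman.segmentOQ θ)) ∧
      (LawsonOsserman.IsTypeII η p →
        LawsonOsserman.IsUnstableCurve n p lam (LawsonOsserman.segmentOQ θ)) := by
  have hLOM := hη.isLOM
  have hpn := ncard_le hp
  have hp0 := multiplicity_pos hrange hp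
  -- Both singular values occur, so `n ≥ 2`; writing `n = j + 2` avoids truncated subtraction in the
  -- exponents of the calibrating form.
  obtain ⟨j, hj⟩ := Nat.exists_eq_add_of_le' (two_le_of_range_eq hlam hrange)
  have hcrit := hLOM.critical_angle hrange hp
  have hp0' : (0 : ℝ) < p := by exact_mod_cast hp0
  have hL : 0 < lam ^ 2 := by positivity
  have hτ : 0 ≤ Real.tan θ ^ 2 := sq_nonneg _
  have hnp : (p : ℝ) + ((n - p : ℕ) : ℝ) = n := by exact_mod_cast Nat.add_sub_of_le hpn
  have hnj : (n : ℝ) = j + 2 := by rw [hj]; push_cast; ring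
  have hcrit' : p * lam ^ 2 * (1 + Real.tan θ ^ 2) = n * (1 + lam ^ 2 * Real.tan θ ^ 2) := by
    rw [← hnp]; linear_combination hcrit
  have hharm : ∀ k : ℕ, HasHarmonicDegree η k → p * lam ^ 2 = k * ((k : ℝ) + n - 1) := by
    intro k hk
    have h := sum_sq_singVal hLOM hk x
    rw [sum_comp_of_range_eq hrange hp fun l => l ^ 2] at h
    simpa using h
  refine ⟨isOrbitGeodesic_segmentOQ hj hpn hcrit, fun hI => ?_, fun hII => ?_⟩
  · refine isStableCurve_segmentOQ hj hpn hcrit ?_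
    have h1 := second_variation_stable_eq hp0' hτ hL hcrit
    rw [hnp] at h1
    rw [Nat.cast_mul, Nat.cast_two, h1, show (j : ℝ) + 1 = n - 1 by rw [hnj]; ring]
    have hq : 0 < 4 * (n : ℝ) ^ 2 / (p * lam ^ 2) := by
      have : (0 : ℝ) < n := by rw [hnj]; positivity
      positivity
    -- For `n ≥ 7`, `(n - 1) ^ 2 / 4 - n = (n ^ 2 - 6 n + 1) / 4` is already positive. For `n = 3`
    -- and `n = 5` it is `-2` and `-1`, to be beaten by `2 n ^ 2 / (k (k + n - 1))`.
    rcases hI with ⟨k, hk, h | h | h⟩ | h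
    · rw [hharm k hk]
      simp only [Prod.mk.injEq] at h
      obtain ⟨rfl, -, rfl⟩ := h
      norm_num
    · rw [hharm k hk]
      simp only [Prod.mk.injEq] at h
      obtain ⟨rfl, -, rfl⟩ := h
      norm_num
    · rw [hharm k hk]
      simp only [Prod.mk.injEq] at h
      obtain ⟨rfl, -, rfl⟩ := h
      norm_num
    · have h7 : (7 : ℝ) ≤ n := by exact_mod_cast h
      nlinarith
  · refine isUnstableCurve_segmentOQ hj hpn hcrit' ?_
    have h1 := second_variation_unstable_eq hp0' hτ hL hcrit'
    rw [show (j : ℝ) + 1 = n - 1 by rw [hnj]; ring]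
    have h2 : (((n : ℝ) - 1) / 2) ^ 2 - (n - 1) * (n * Real.tan θ ^ 2) +
        (n * (1 - lam ^ 2 * Real.tan θ ^ 2) * (1 + Real.tan θ ^ 2) /
          (1 + lam ^ 2 * Real.tan θ ^ 2) + n ^ 2 * Real.tan θ ^ 2) =
        ((n - 1) / 2) ^ 2 - n + 2 * n ^ 2 / (p * lam ^ 2) := by
      linear_combination h1
    rw [h2]
    obtain ⟨k, hk, h | h⟩ := hII
    · rw [hharm k hk]
      obtain ⟨h3, hk4⟩ := h
      simp only [Prod.mk.injEq] at h3
      obtain ⟨rfl, -⟩ := h3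
      have hk4' : (4 : ℝ) ≤ k := by exact_mod_cast hk4
      -- For `k ≥ 4` the term is at most `18 / 24`, below the `2` needed to cancel the deficit.
      have h5 : 2 * ((3 : ℕ) : ℝ) ^ 2 / (k * (k + (3 : ℕ) - 1)) < 2 := by
        rw [div_lt_iff₀ (by push_cast; nlinarith)]
        push_cast
        nlinarith
      norm_num at h5 ⊢
      linarith
    · rw [hharm k hk]
      obtain ⟨h3, hk6⟩ := h
      simp only [Prod.mk.injEq] at h3
      obtain ⟨rfl, -⟩ := h3
      have hk6' : (6 : ℝ) ≤ k := by exact_mod_cast hk6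
      -- For `k ≥ 6` the term is at most `50 / 60`, below the `1` needed; `k = 4` gives `50 / 32`,
      -- on the stable side.
      have h5 : 2 * ((5 : ℕ) : ℝ) ^ 2 / (k * (k + (5 : ℕ) - 1)) < 1 := by
        rw [div_lt_iff₀ (by push_cast; nlinarith)]
        push_cast
        nlinarith
      norm_num at h5 ⊢
      linarith
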